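/- **Proposition 4.2.** Let $\tau>0$, let $f:\mathbb R^d\times\mathbb R^d\to\mathbb R^d$ and $g:\mathbb R^d\times\mathbb R^d\to\mathbb R^{d\times m}$, and let $W$ be an $m$-dimensional Brownian motion on a probability space $(\Omega,\mathcal F,\mathbb P)$. Here $|\cdot|$ is the Euclidean norm on $\mathbb R^d$ and the Frobenius norm on $\mathbb R^{d\times m}$; $C=C([-\tau,0];\mathbb R^d)$ carries the norm $\|X\|=\sup_{-\tau\le\theta\le0}|X(\theta)|$, and $B(M)=\{X\in C:\|X\|\le M\}$. Suppose that: * **(H1)** for every $R>0$ there is $\ell_R>0$ with $|f(x,y)-f(\bar x,\bar y)|\vee|g(x,y)-g(\bar x,\bar y)|\le \ell_R(|x-\bar x|+|y-\bar y|)$ whenever $|x|\vee|\bar x|\vee|y|\vee|\bar y|\le R$; * **(H2)** there are $\alpha\ge 2$ and nonnegative constants $a_1,a_2,a_3$ with $a_2>a_3$ such that $\langle 2x,f(x,y)\rangle+|g(x,y)|^2\le a_1-a_2|x|^\alpha+a_3|y|^\alpha$ for all $x,y\in\mathbb R^d$; * **(H3)** there are nonnegative constants $b_1,b_2,b_3,b_4$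 with $b_1>b_2$, $b_3>b_4$, and a continuous $V:\mathbb R^d\times\mathbb R^d\to[0,\infty)$ with $V(x,x)=0$ for all $x$, such that for all $x,\bar x,y,\bar y\in\mathbb R^d$ $$2\langle x-\bar x,f(x,y)-f(\bar x,\bar y)\rangle+|g(x,y)-g(\bar x,\bar y)|^2\le -b_1|x-\bar x|^2+b_2|y-\bar y|^2-b_3V(x,\bar x)+b_4V(y,\bar y).$$ Let $\Phi:[1,\infty)\to[0,\infty)$ be continuous and strictly increasing with $\Phi(R)\to\infty$ as $R\to\infty$ and $$\sup_{|x|\vee|\bar x|\vee|y|\vee|\bar y|\le R}\left(\frac{|f(x,y)-f(\bar x,\bar y)|}{|x-\bar x|+1\wedge|y-\bar y|}+\frac{|g(x,y)-g(\bar x,\bar y)|^2}{(|x-\bar x|+1\wedge|y-\bar y|)^2}\right)\le\Phi(R)\qquad(R\ge1),$$ with $0/0$ read as $0$. Let $\nu\in(0,1/3]$, $K=1\vee\Phi(1)\vee|f(0,0)|\vee|g(0,0)|^2$, and for $\triangle\in(0,1)$ let $\Gamma^{\triangle}(x)=\big(|x|\wedge\Phi^{-1}(K\triangle^{-\nu})\big)\,x/|x|$,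 with $x/|x|:=0$ for $x=0$. For a step size $\triangle=\tau/N\in(0,1)$ with a positive integer $N$, put $t_k=k\triangle$ and, for $\xi\in C$, define $\breve u^{\xi,\triangle}(t_k)=\xi(t_k)$ for $-N\le k\le 0$, $u^{\xi,\triangle}(t_k)=\Gamma^{\triangle}(\breve u^{\xi,\triangle}(t_k))$ for $k\ge -N$, and for $k\ge0$ $$\breve u^{\xi,\triangle}(t_{k+1})=u^{\xi,\triangle}(t_k)+f\big(u^{\xi,\triangle}(t_k),u^{\xi,\triangle}(t_{k-N})\big)\triangle+g\big(u^{\xi,\triangle}(t_k),u^{\xi,\triangle}(t_{k-N})\big)\big(W(t_{k+1})-W(t_k)\big).$$ Let $y^{\xi,\triangle}(t)=\Gamma^{\triangle}(\xi(t))$ for $t\in[-\tau,0]$ and $y^{\xi,\triangle}(t)=\frac{t_{k+1}-t}{\triangle}u^{\xi,\triangle}(t_k)+\frac{t-t_k}{\triangle}u^{\xi,\triangle}(t_{k+1})$ for $t\in[t_k,t_{k+1}]$, $k\ge0$. The truncated Euler–Maruyama segment process (TEMSP) is $Y^{\xi,\triangle}_{t_k}(\theta)=y^{\xi,\triangle}(t_k+\theta)$,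 $\theta\in[-\tau,0]$, $k\ge0$. Let $\hat\triangle_1,\hat\triangle_2\in(0,1)$ satisfy $a_2-6K^2\hat\triangle_1^{1-2\nu}>a_3$ and $b_1-4K^2\hat\triangle_2^{1-2\nu}>b_2$, and put $\hat\triangle=\hat\triangle_1\wedge\hat\triangle_2$. Then for any $M>0$ and $\varepsilon>0$ there is $\bar T=\bar T(\hat\triangle,M,\varepsilon)>\tau$ such that for every step size $\triangle=\tau/N\in(0,\hat\triangle]$ and every integer $k\ge0$ with $k\triangle\ge\bar T$, $$\sup_{\xi,\zeta\in B(M)}\mathbb P\big\{\|Y_{t_k}^{\xi,\triangle}-Y_{t_k}^{\zeta,\triangle}\|\ge\varepsilon\big\}<\varepsilon.$$ -/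

import Mathlib

open MeasureTheory ProbabilityTheory
open scoped NNReal ENNReal Matrix

-- The norm on `d × m` matrices is the Frobenius (Hilbert-Schmidt) norm `|A| = √(trace (Aᵀ A))`.
attribute [local instance] Matrix.frobeniusNormedAddCommGroup

namespace TEMSP

/-- `ℝ^d` with its Euclidean norm and inner product. -/
abbrev E (d : ℕ) : Type := EuclideanSpace ℝ (Fin d)

/-- The space `C = C([-τ, 0]; ℝ^d)` with the supremum norm. -/
abbrev Seg (d : ℕ) (τ : ℝ) : Type := C(Set.Icc (-τ) (0 : ℝ), E d)

/-- The set `B(M)` of all `X ∈ C` with `‖X‖ ≤ M`. -/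
def B (d : ℕ) (τ M : ℝ) : Set (Seg d τ) := {X | ‖X‖ ≤ M}

/-- Local Lipschitz condition (H1). -/
def H1 {d m : ℕ} (f : E d → E d → E d) (g : E d → E d → Matrix (Fin d) (Fin m) ℝ) : Prop :=
  ∀ R : ℝ, 0 < R → ∃ ℓ : ℝ, 0 < ℓ ∧ ∀ x x' y y' : E d,
    ‖x‖ ≤ R → ‖x'‖ ≤ R → ‖y‖ ≤ R → ‖y'‖ ≤ R →
      max ‖f x y - f x' y'‖ ‖g x y - g x' y'‖ ≤ ℓ * (‖x - x'‖ + ‖y - y'‖)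

/-- Dissipativity condition (H2) with the constants `α, a₁, a₂, a₃`. -/
structure H2 {d m : ℕ} (f : E d → E d → E d) (g : E d → E d → Matrix (Fin d) (Fin m) ℝ)
    (α a₁ a₂ a₃ : ℝ) : Prop where
  two_le : 2 ≤ α
  a₁_nonneg : 0 ≤ a₁
  a₂_nonneg : 0 ≤ a₂
  a₃_nonneg : 0 ≤ a₃
  lt : a₃ < a₂
  bound : ∀ x y : E d,
    inner ℝ ((2 : ℝ) • x) (f x y) + ‖g x y‖ ^ 2 ≤ a₁ - a₂ * ‖x‖ ^ α + a₃ * ‖y‖ ^ α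

/-- The class of continuous functions `V : ℝ^d × ℝ^d → [0, ∞)` vanishing on the diagonal. -/
structure IsHatC {d : ℕ} (V : E d → E d → ℝ) : Prop where
  continuous : Continuous (fun p : E d × E d => V p.1 p.2)
  nonneg : ∀ x y, 0 ≤ V x y
  diag : ∀ x, V x x = 0

/-- Contractivity condition (H3) with the constants `b₁, b₂, b₃, b₄` and the function `V`. -/
structure H3 {d m : ℕ} (f : E d → E d → E d) (g : E d → E d → Matrix (Fin d) (Fin m) ℝ)
    (b₁ b₂ b₃ b₄ : ℝ) (V : E d → E d → ℝ) : Prop where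
  b₁_nonneg : 0 ≤ b₁
  b₂_nonneg : 0 ≤ b₂
  b₃_nonneg : 0 ≤ b₃
  b₄_nonneg : 0 ≤ b₄
  lt₁₂ : b₂ < b₁
  lt₃₄ : b₄ < b₃
  hatC : IsHatC V
  bound : ∀ x x' y y' : E d,
    2 * inner ℝ (x - x') (f x y - f x' y') + ‖g x y - g x' y'‖ ^ 2
      ≤ -b₁ * ‖x - x'‖ ^ 2 + b₂ * ‖y - y'‖ ^ 2 - b₃ * V x x' + b₄ * V y y'

/-- The admissible control functions `Φ : [1, ∞) → [0, ∞)`: continuous, strictly increasing,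
tending to infinity, and dominating the local difference quotients of `f` and `g`
(a quotient `0 / 0` is read as `0`). -/
structure IsControl {d m : ℕ} (f : E d → E d → E d)
    (g : E d → E d → Matrix (Fin d) (Fin m) ℝ) (Φ : Set.Ici (1 : ℝ) → ℝ) : Prop where
  nonneg : ∀ R, 0 ≤ Φ R
  continuous : Continuous Φ
  strictMono : StrictMono Φ
  tendsto : Filter.Tendsto Φ Filter.atTop Filter.atTop
  bound : ∀ R : Set.Ici (1 : ℝ), ∀ x x' y y' : E d,
    ‖x‖ ≤ (R : ℝ) → ‖x'‖ ≤ (R : ℝ) → ‖y‖ ≤ (R : ℝ) → ‖y'‖ ≤ (R : ℝ) →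
      ‖f x y - f x' y'‖ / (‖x - x'‖ + min 1 ‖y - y'‖)
        + ‖g x y - g x' y'‖ ^ 2 / (‖x - x'‖ + min 1 ‖y - y'‖) ^ 2 ≤ Φ R

/-- `K = 1 ∨ Φ(1) ∨ |f(0,0)| ∨ |g(0,0)|²`. -/
noncomputable def constK {d m : ℕ} (f : E d → E d → E d)
    (g : E d → E d → Matrix (Fin d) (Fin m) ℝ) (Φ : Set.Ici (1 : ℝ) → ℝ) : ℝ :=
  max 1 (max (Φ ⟨1, Set.self_mem_Ici⟩) (max ‖f 0 0‖ (‖g 0 0‖ ^ 2)))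

/-- The truncation level `Φ⁻¹(K Δ^{-ν}) ∈ [1, ∞)`. For an admissible `Φ` and `Δ ∈ (0, 1)`, `ν > 0`
the number `K Δ^{-ν} ≥ Φ(1)` lies in the range of `Φ`, so `Function.invFun` is the true inverse. -/
noncomputable def level {d m : ℕ} (f : E d → E d → E d)
    (g : E d → E d → Matrix (Fin d) (Fin m) ℝ) (Φ : Set.Ici (1 : ℝ) → ℝ) (ν Δ : ℝ) :
    Set.Ici (1 : ℝ) :=
  Function.invFun Φ (constK f g Φ * Δ ^ (-ν))

/-- The truncation map at level `ρ`: `x ↦ (|x| ∧ ρ) x / |x|`, with `0 / |0| = 0`. -/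
noncomputable def trunc {d : ℕ} (ρ : Set.Ici (1 : ℝ)) (x : E d) : E d :=
  min ‖x‖ (ρ : ℝ) • (‖x‖⁻¹ • x)

/-- An initial segment `ξ : [-τ, 0] → ℝ^d` as a function of a real variable; only the arguments
in `[-τ, 0]` matter (elsewhere it is continued by its boundary values). -/
noncomputable def evalAt {d : ℕ} {τ : ℝ} (hτ : 0 < τ) (ξ : Seg d τ) : ℝ → E d :=
  Set.IccExtend (neg_nonpos.2 hτ.le) ξ

/-- The untruncated iterate `ŭ(t_k)`, `t_k = k Δ`, along one path `w` of the noise: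
`ŭ(t_k) = ξ(t_k)` for `-N ≤ k ≤ 0`, and with `u = trunc ŭ`
`ŭ(t_k) = u(t_{k-1}) + f(u(t_{k-1}), u(t_{k-1-N})) Δ + g(u(t_{k-1}), u(t_{k-1-N})) (w(t_k) - w(t_{k-1}))`
for `k ≥ 1`. Indices below `-N` are never reached from `k ≥ -N`. -/
noncomputable def breveU {d m : ℕ} (f : E d → E d → E d)
    (g : E d → E d → Matrix (Fin d) (Fin m) ℝ) (ρ : Set.Ici (1 : ℝ)) {τ : ℝ} (hτ : 0 < τ)
    (Δ : ℝ) (N : ℕ) (ξ : Seg d τ) (w : ℝ≥0 → E m) (k : ℤ) : E d :=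
  if k ≤ 0 then evalAt hτ ξ ((k : ℝ) * Δ)
  else
    trunc ρ (breveU f g ρ hτ Δ N ξ w (k - 1))
      + Δ • f (trunc ρ (breveU f g ρ hτ Δ N ξ w (k - 1)))
            (trunc ρ (breveU f g ρ hτ Δ N ξ w (k - 1 - N)))
      + WithLp.toLp 2
          (g (trunc ρ (breveU f g ρ hτ Δ N ξ w (k - 1)))
              (trunc ρ (breveU f g ρ hτ Δ N ξ w (k - 1 - N))) *ᵥ
            (w ((k : ℝ) * Δ).toNNReal - w (((k : ℝ) - 1) * Δ).toNNReal).ofLp)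
termination_by k.toNat
decreasing_by all_goals omega

/-- The truncated iterate `u(t_k) = trunc (ŭ(t_k))`. -/
noncomputable def u {d m : ℕ} (f : E d → E d → E d)
    (g : E d → E d → Matrix (Fin d) (Fin m) ℝ) (ρ : Set.Ici (1 : ℝ)) {τ : ℝ} (hτ : 0 < τ)
    (Δ : ℝ) (N : ℕ) (ξ : Seg d τ) (w : ℝ≥0 → E m) (k : ℤ) : E d :=
  trunc ρ (breveU f g ρ hτ Δ N ξ w k)

/-- Linear interpolation of a sequence indexed by the integers. -/
noncomputable def interp {d : ℕ} (v : ℤ → E d) (s : ℝ) : E d :=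
  ((⌊s⌋ : ℝ) + 1 - s) • v ⌊s⌋ + (s - (⌊s⌋ : ℝ)) • v (⌊s⌋ + 1)

/-- The continuous process `y(t)`: equal to `trunc (ξ(t))` on `[-τ, 0]`, and to
`((t_{k+1} - t) / Δ) u(t_k) + ((t - t_k) / Δ) u(t_{k+1})` on `[t_k, t_{k+1}]`, `k ≥ 0`. -/
noncomputable def y {d m : ℕ} (f : E d → E d → E d)
    (g : E d → E d → Matrix (Fin d) (Fin m) ℝ) (ρ : Set.Ici (1 : ℝ)) {τ : ℝ} (hτ : 0 < τ)
    (Δ : ℝ) (N : ℕ) (ξ : Seg d τ) (w : ℝ≥0 → E m) (t : ℝ) : E d :=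
  if t ≤ 0 then trunc ρ (evalAt hτ ξ t) else interp (u f g ρ hτ Δ N ξ w) (t / Δ)

theorem continuous_trunc {d : ℕ} (ρ : Set.Ici (1 : ℝ)) :
    Continuous (trunc ρ : E d → E d) := by
  have hρ : (0 : ℝ) ≤ ρ := zero_le_one.trans ρ.2
  rw [continuous_iff_continuousAt]
  intro x
  by_cases hx : x = 0
  · subst hx
    have h0 : trunc ρ (0 : E d) = 0 := by simp [trunc]
    have hb : ∀ z : E d, ‖trunc ρ z‖ ≤ ‖z‖ := by
      intro z
      by_cases hz : z = 0
      · subst hz; simp [h0]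
      · have hz' : ‖z‖ ≠ 0 := norm_ne_zero_iff.2 hz
        rw [trunc, norm_smul, norm_smul, norm_inv, norm_norm, inv_mul_cancel₀ hz', mul_one,
          Real.norm_of_nonneg (le_min (norm_nonneg z) hρ)]
        exact min_le_left _ _
    unfold ContinuousAt
    rw [h0]
    refine squeeze_zero_norm hb ?_
    simpa using (continuous_norm (E := E d)).tendsto 0
  · have hx' : ‖x‖ ≠ 0 := norm_ne_zero_iff.2 hx
    unfold trunc
    fun_prop (disch := exact hx')

theorem interp_eq {d : ℕ} (v : ℤ → E d) (n : ℤ) {s : ℝ} (hs : s ∈ Set.Icc (n : ℝ) (n + 1)) :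
    interp v s = ((n : ℝ) + 1 - s) • v n + (s - n) • v (n + 1) := by
  rcases eq_or_lt_of_le hs.2 with h | h
  · subst h
    simp [interp]
  · have hf : ⌊s⌋ = n := Int.floor_eq_iff.2 ⟨hs.1, h⟩
    rw [interp, hf]

theorem continuous_interp {d : ℕ} (v : ℤ → E d) : Continuous (interp v) := by
  rw [continuous_iff_continuousAt]
  intro s
  have hc : ∀ n : ℤ, ContinuousOn (interp v) (Set.Icc (n : ℝ) (n + 1)) := by
    intro n
    refine ContinuousOn.congr (f := fun s : ℝ => ((n : ℝ) + 1 - s) • v n + (s - n) • v (n + 1))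
      (by fun_prop) fun s hs => interp_eq v n hs
  have h1 := hc (⌊s⌋ - 1)
  have h2 := hc ⌊s⌋
  have h3 := (h1.union_of_isClosed h2 isClosed_Icc isClosed_Icc)
  refine h3.continuousAt ?_
  refine Filter.mem_of_superset
    (Ioo_mem_nhds (a := (⌊s⌋ : ℝ) - 1) (b := (⌊s⌋ : ℝ) + 1) ?_ (Int.lt_floor_add_one s)) ?_
  · linarith [Int.floor_le s]
  · intro r hr
    rcases le_total r (⌊s⌋ : ℝ) with h | h
    · left; push_cast; exact ⟨hr.1.le, by linarith⟩
    · right; exact ⟨h, hr.2.le⟩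

theorem continuous_y {d m : ℕ} (f : E d → E d → E d)
    (g : E d → E d → Matrix (Fin d) (Fin m) ℝ) (ρ : Set.Ici (1 : ℝ)) {τ : ℝ} (hτ : 0 < τ)
    (Δ : ℝ) (N : ℕ) (ξ : Seg d τ) (w : ℝ≥0 → E m) :
    Continuous (y f g ρ hτ Δ N ξ w) := by
  refine Continuous.if_le ((continuous_trunc ρ).comp ξ.continuous.Icc_extend')
    ((continuous_interp _).comp (continuous_id.div_const Δ)) continuous_id continuous_const ?_
  intro t ht
  have ht0 : t = 0 := ht
  subst ht0
  simp [interp, u, breveU, evalAt]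

/-- The segment `Y_{t_k} ∈ C`, `Y_{t_k}(θ) = y(t_k + θ)`, along one path `w` of the noise, started
from `ξ`, with step size `Δ = τ / N`. Evaluated at the paths of a Brownian motion this is the
truncated Euler-Maruyama segment process. -/
noncomputable def Y {d m : ℕ} (f : E d → E d → E d)
    (g : E d → E d → Matrix (Fin d) (Fin m) ℝ) (Φ : Set.Ici (1 : ℝ) → ℝ) (ν : ℝ)
    {τ : ℝ} (hτ : 0 < τ) (Δ : ℝ) (N : ℕ) (ξ : Seg d τ) (w : ℝ≥0 → E m) (k : ℕ) : Seg d τ where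
  toFun θ := y f g (level f g Φ ν Δ) hτ Δ N ξ w ((k : ℝ) * Δ + (θ : ℝ))
  continuous_toFun := (continuous_y f g _ hτ Δ N ξ w).comp (by fun_prop)

/-- An `m`-dimensional standard Brownian motion: the coordinates are independent real Brownian
motions. -/
structure IsBrownianMotion {Ω : Type*} [MeasurableSpace Ω] (P : Measure Ω) {m : ℕ}
    (W : ℝ≥0 → Ω → E m) : Prop where
  measurable : ∀ t, Measurable (W t)
  coord : ∀ i : Fin m, IsBrownianReal (fun t ω => W t ω i) P
  indep : iIndepFun (fun (i : Fin m) (ω : Ω) (t : ℝ≥0) => W t ω i) P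

end TEMSP

namespace TEMSP

/-! Run the scheme from two initial segments with the same noise and follow the squared distance
`e_k` of the truncated iterates. Truncation is the projection onto a ball, so it does not increase
distances (`norm_trunc_sub_trunc_le`). The next noise increment is centred and independent of the
past, so the second moment of the untruncated difference can be computed exactly
(`IsWhiteNoise.setIntegral_norm_sq`). Condition (H3) then yields a contraction, up to the explicit
Euler error `Δ² |f - f'|²`. At the truncation level `ρ` one has `Φ(ρ)² Δ = K² Δ^(1-2ν) ≤ q`, where
`q = K² Δ₂^(1-2ν)`, so this error costs at most `2qΔ` times the current and delayed squared
distances. The result is a delay difference inequality with rates `b₁ - 2q` and `b₂ + 2q`; their gap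
is positive by the condition on `Δ₂` and does not depend on the step.

Add to the current expectation the forcing still to be released by the preceding delay window. This
energy `L_n` decreases, and what it loses controls the time integral of `L` itself, so `nΔ L_n ≤ D
L_0` with `D` independent of the step (`mul_windowEnergy_le`). On `B(M)` the energy `L_0` is bounded
uniformly.

To pass from moments to the supremum over one delay window starting at `n`, note that all forcing
during that window is delayed, hence already known at time `n`. Adding the remaining forcing to `e`
gives a nonnegative supermartingale with initial mean exactly `L_n`, and a maximal inequality
applies (`mul_prob_errSq_window_le`). Between grid points the segments are linear, so the grid
values control the segment norm. -/

/-! ### Discrete white noise and its filtration. -/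

/-- The family of independent, centred, square integrable variables with variance `s`, indexed by a
coordinate and a time index. -/
structure IsWhiteNoise {Ω ι : Type*} [MeasurableSpace Ω] (P : Measure Ω) (X : ι × ℕ → Ω → ℝ)
    (s : ℝ) : Prop where
  measurable : ∀ p, Measurable (X p)
  memLp : ∀ p, MemLp (X p) 2 P
  mean : ∀ p, ∫ ω, X p ω ∂P = 0
  var : ∀ p, ∫ ω, X p ω * X p ω ∂P = s
  indep : iIndepFun X P

/-- The σ-algebra generated by the noise variables with time index less than `j`. -/
@[reducible]
def past {Ω ι : Type*} (X : ι × ℕ → Ω → ℝ) (j : ℕ) : MeasurableSpace Ω :=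
  ⨆ p ∈ {p : ι × ℕ | p.2 < j}, MeasurableSpace.comap (X p) inferInstance

/-- The σ-algebra generated by the noise variables with time index `j`. -/
@[reducible]
def present {Ω ι : Type*} (X : ι × ℕ → Ω → ℝ) (j : ℕ) : MeasurableSpace Ω :=
  ⨆ p ∈ {p : ι × ℕ | p.2 = j}, MeasurableSpace.comap (X p) inferInstance

section Noise

variable {Ω ι : Type*}

theorem past_mono (X : ι × ℕ → Ω → ℝ) {i j : ℕ} (h : i ≤ j) : past X i ≤ past X j :=
  biSup_mono fun _ hp => lt_of_lt_of_le hp h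

theorem measurable_past (X : ι × ℕ → Ω → ℝ) {p : ι × ℕ} {j : ℕ} (h : p.2 < j) :
    Measurable[past X j] (X p) :=
  Measurable.of_comap_le
    (le_biSup (fun p => MeasurableSpace.comap (X p) inferInstance) (i := p) h)

theorem measurable_present (X : ι × ℕ → Ω → ℝ) (l : ι) (j : ℕ) :
    Measurable[present X j] (X (l, j)) :=
  Measurable.of_comap_le
    (le_biSup (fun p => MeasurableSpace.comap (X p) inferInstance) (i := (l, j)) rfl)

variable [mΩ : MeasurableSpace Ω] {P : Measure Ω}

namespace IsWhiteNoise

variable {X : ι × ℕ → Ω → ℝ} {s : ℝ}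

theorem past_le (h : IsWhiteNoise P X s) (j : ℕ) : past X j ≤ mΩ :=
  iSup₂_le fun p _ => (h.measurable p).comap_le

theorem indep_past_present (h : IsWhiteNoise P X s) (j : ℕ) : Indep (past X j) (present X j) P := by
  refine indep_iSup_of_disjoint (fun p => (h.measurable p).comap_le) h.indep.iIndep ?_
  rw [Set.disjoint_left]
  intro p hp hp'
  simp only [Set.mem_ofPred_eq] at hp hp'
  omega

theorem integral_mul_eq (h : IsWhiteNoise P X s) [DecidableEq ι] (l l' : ι) (j : ℕ) :
    ∫ ω, X (l, j) ω * X (l', j) ω ∂P = if l = l' then s else 0 := by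
  split_ifs with hl
  · subst hl; exact h.var _
  · have hne : (l, j) ≠ (l', j) := fun h' => hl (congrArg Prod.fst h')
    rw [(h.indep.indepFun hne).integral_fun_mul_eq_mul_integral
      (h.measurable _).aestronglyMeasurable (h.measurable _).aestronglyMeasurable, h.mean]
    simp

/-- A bounded variable depending on the past times an integrable variable depending on the
present. -/
theorem integral_past_mul (h : IsWhiteNoise P X s) {j : ℕ} {φ ψ : Ω → ℝ} {C : ℝ}
    (hφ : Measurable[past X j] φ) (hC : ∀ ω, |φ ω| ≤ C) (hψ : Measurable[present X j] ψ)
    (hi : Integrable ψ P) :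
    Integrable (fun ω => φ ω * ψ ω) P ∧
      ∫ ω, φ ω * ψ ω ∂P = (∫ ω, φ ω ∂P) * ∫ ω, ψ ω ∂P := by
  have hφm : Measurable φ := hφ.mono (h.past_le j) le_rfl
  have hind : IndepFun φ ψ P :=
    indep_of_indep_of_le (h.indep_past_present j) hφ.comap_le hψ.comap_le
  exact ⟨hi.bdd_mul hφm.aestronglyMeasurable (.of_forall hC),
    hind.integral_fun_mul_eq_mul_integral hφm.aestronglyMeasurable hi.aestronglyMeasurable⟩

/-- Expand the square: terms linear in the noise vanish by independence and centring, products of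
distinct coordinates are uncorrelated, and only the diagonal survives, with factor `s`. Boundedness
of the coefficients makes every term integrable; the truncated scheme provides it. -/
theorem integral_sq_add_sum [IsProbabilityMeasure P] (h : IsWhiteNoise P X s) [Fintype ι]
    {j : ℕ} {a : Ω → ℝ} {γ : ι → Ω → ℝ} {C : ℝ} (ha : Measurable[past X j] a) (haC : ∀ ω, |a ω| ≤ C)
    (hγ : ∀ l, Measurable[past X j] (γ l)) (hγC : ∀ l ω, |γ l ω| ≤ C) :
    Integrable (fun ω => (a ω + ∑ l, γ l ω * X (l, j) ω) ^ 2) P ∧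
      ∫ ω, (a ω + ∑ l, γ l ω * X (l, j) ω) ^ 2 ∂P
        = ∫ ω, (a ω ^ 2 + s * ∑ l, γ l ω ^ 2) ∂P := by
  classical
  have hb : ∀ {φ : Ω → ℝ}, Measurable[past X j] φ → (∀ ω, |φ ω| ≤ C * C) → Integrable φ P :=
    fun hφ hφC => Integrable.of_bound (hφ.mono (h.past_le j) le_rfl).aestronglyMeasurable (C * C)
      (.of_forall hφC)
  have hprod : ∀ {φ ψ : Ω → ℝ}, (∀ ω, |φ ω| ≤ C) → (∀ ω, |ψ ω| ≤ C) →
      ∀ ω, |φ ω * ψ ω| ≤ C * C := fun h1 h2 ω => by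
    rw [abs_mul]
    exact mul_le_mul (h1 ω) (h2 ω) (abs_nonneg _) ((abs_nonneg _).trans (h1 ω))
  have e : (fun ω => (a ω + ∑ l, γ l ω * X (l, j) ω) ^ 2) = fun ω => a ω * a ω
      + ∑ l, 2 * (a ω * γ l ω * X (l, j) ω)
      + ∑ l, ∑ l', γ l ω * γ l' ω * (X (l, j) ω * X (l', j) ω) := by
    funext ω
    rw [add_sq, pow_two (∑ l, γ l ω * X (l, j) ω), Finset.sum_mul_sum, Finset.mul_sum, pow_two]
    congr 1
    · congr 1
      exact Finset.sum_congr rfl fun l _ => by ring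
    · exact Finset.sum_congr rfl fun l _ => Finset.sum_congr rfl fun l' _ => by ring
  have i0 : Integrable (fun ω => a ω * a ω) P := hb (ha.mul ha) (hprod haC haC)
  have q1 : ∀ l, Integrable (fun ω => a ω * γ l ω * X (l, j) ω) P ∧
      ∫ ω, a ω * γ l ω * X (l, j) ω ∂P = (∫ ω, a ω * γ l ω ∂P) * ∫ ω, X (l, j) ω ∂P :=
    fun l => h.integral_past_mul (ha.mul (hγ l)) (hprod haC (hγC l))
    (measurable_present X l j) ((h.memLp (l, j)).integrable one_le_two)
  have q2 : ∀ l l', Integrable (fun ω => γ l ω * γ l' ω * (X (l, j) ω * X (l', j) ω)) P ∧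
      ∫ ω, γ l ω * γ l' ω * (X (l, j) ω * X (l', j) ω) ∂P
        = (∫ ω, γ l ω * γ l' ω ∂P) * ∫ ω, X (l, j) ω * X (l', j) ω ∂P :=
    fun l l' => h.integral_past_mul ((hγ l).mul (hγ l')) (hprod (hγC l) (hγC l'))
    ((measurable_present X l j).mul (measurable_present X l' j))
    ((h.memLp (l, j)).integrable_mul (h.memLp (l', j)))
  have i1 : Integrable (fun ω => ∑ l, 2 * (a ω * γ l ω * X (l, j) ω)) P :=
    integrable_finsetSum _ fun l _ => ((q1 l).1.const_mul 2)
  have i2 : Integrable (fun ω => ∑ l, ∑ l', γ l ω * γ l' ω * (X (l, j) ω * X (l', j) ω)) P :=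
    integrable_finsetSum _ fun l _ => integrable_finsetSum _ fun l' _ => (q2 l l').1
  have iγ : ∀ l, Integrable (fun ω => γ l ω * γ l ω) P :=
    fun l => hb ((hγ l).mul (hγ l)) (hprod (hγC l) (hγC l))
  rw [e]
  refine ⟨(i0.add i1).add i2, ?_⟩
  have z1 : ∫ ω, ∑ l, 2 * (a ω * γ l ω * X (l, j) ω) ∂P = 0 := by
    rw [integral_finsetSum _ fun l _ => ((q1 l).1.const_mul 2)]
    refine Finset.sum_eq_zero fun l _ => ?_
    rw [integral_const_mul, (q1 l).2, h.mean]
    simp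
  have z2 : ∫ ω, ∑ l, ∑ l', γ l ω * γ l' ω * (X (l, j) ω * X (l', j) ω) ∂P
      = ∫ ω, s * ∑ l, γ l ω * γ l ω ∂P := by
    rw [integral_finsetSum _ fun l _ => integrable_finsetSum _ fun l' _ => (q2 l l').1,
      integral_const_mul, integral_finsetSum _ fun l _ => iγ l, Finset.mul_sum]
    refine Finset.sum_congr rfl fun l _ => ?_
    rw [integral_finsetSum _ fun l' _ => (q2 l l').1, Finset.sum_eq_single l]
    · rw [(q2 l l).2, h.integral_mul_eq, if_pos rfl, mul_comm]
    · intro l' _ hl'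
      rw [(q2 l l').2, h.integral_mul_eq, if_neg (Ne.symm hl'), mul_zero]
    · simp
  rw [integral_add (by exact i0.add i1) i2, integral_add i0 i1, z1, z2, add_zero, ← integral_add i0]
  · simp only [pow_two]
  · exact (integrable_finsetSum _ fun l _ => iγ l).const_mul s

end IsWhiteNoise

end Noise

/-! ### Frobenius norm and the one-step isometry. -/

theorem frobenius_norm_sq {n m : ℕ} (A : Matrix (Fin n) (Fin m) ℝ) :
    ‖A‖ ^ 2 = ∑ i, ∑ l, A i l ^ 2 := by
  rw [Matrix.frobenius_norm_def, ← Real.sqrt_eq_rpow, Real.sq_sqrt (by positivity)]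
  simp

theorem abs_entry_le_frobenius_norm {n m : ℕ} (A : Matrix (Fin n) (Fin m) ℝ) (i : Fin n)
    (l : Fin m) : |A i l| ≤ ‖A‖ := by
  refine abs_le_of_sq_le_sq ?_ (norm_nonneg A)
  rw [frobenius_norm_sq]
  calc A i l ^ 2 ≤ ∑ l, A i l ^ 2 :=
        Finset.single_le_sum (f := fun l => A i l ^ 2) (fun l _ => sq_nonneg _) (Finset.mem_univ l)
    _ ≤ _ := Finset.single_le_sum (f := fun i => ∑ l, A i l ^ 2)
        (fun i _ => Finset.sum_nonneg fun l _ => sq_nonneg _) (Finset.mem_univ i)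

/-- Isometry for one step: the noise is orthogonal to the past. -/
theorem IsWhiteNoise.setIntegral_norm_sq {Ω : Type*} [MeasurableSpace Ω] {P : Measure Ω}
    [IsProbabilityMeasure P] {d m : ℕ} {X : Fin m × ℕ → Ω → ℝ} {s : ℝ} (h : IsWhiteNoise P X s)
    {j : ℕ} {a : Ω → E d} {G : Ω → Matrix (Fin d) (Fin m) ℝ} {C : ℝ}
    (ha : Measurable[past X j] a) (haC : ∀ ω, ‖a ω‖ ≤ C)
    (hG : ∀ i l, Measurable[past X j] fun ω => G ω i l) (hGC : ∀ ω, ‖G ω‖ ≤ C)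
    {A : Set Ω} (hA : MeasurableSet[past X j] A) :
    IntegrableOn (fun ω => ‖a ω + WithLp.toLp 2 (G ω *ᵥ fun l => X (l, j) ω)‖ ^ 2) A P ∧
      ∫ ω in A, ‖a ω + WithLp.toLp 2 (G ω *ᵥ fun l => X (l, j) ω)‖ ^ 2 ∂P
        = ∫ ω in A, (‖a ω‖ ^ 2 + s * ‖G ω‖ ^ 2) ∂P := by
  have hAm : MeasurableSet A := h.past_le j A hA
  have hcoord : ∀ i, Measurable[past X j] fun ω => a ω i := fun i =>
    (show Measurable fun x : E d => x i by fun_prop).comp ha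
  have hle : ∀ (B : Set Ω) (φ : Ω → ℝ), (∀ ω, |φ ω| ≤ C) → ∀ ω, |B.indicator φ ω| ≤ C := by
    intro B φ hφ ω
    by_cases hω : ω ∈ B
    · rw [Set.indicator_of_mem hω]; exact hφ ω
    · rw [Set.indicator_of_notMem hω, abs_zero]; exact (abs_nonneg _).trans (hφ ω)
  -- The indicator of `A` is measurable with respect to the past, so it can be absorbed into the
  -- coefficients; the scalar identity then applies to each coordinate.
  have key := fun i => h.integral_sq_add_sum (j := j) (a := A.indicator fun ω => a ω i)
    (γ := fun l => A.indicator fun ω => G ω i l) (C := C) ((hcoord i).indicator hA)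
    (hle A _ fun ω => (PiLp.norm_apply_le (a ω) i).trans (haC ω))
    (fun l => (hG i l).indicator hA)
    (fun l => hle A _ fun ω => (abs_entry_le_frobenius_norm (G ω) i l).trans (hGC ω))
  have e1 : A.indicator (fun ω => ‖a ω + WithLp.toLp 2 (G ω *ᵥ fun l => X (l, j) ω)‖ ^ 2)
      = fun ω => ∑ i, (A.indicator (fun ω => a ω i) ω
        + ∑ l, A.indicator (fun ω => G ω i l) ω * X (l, j) ω) ^ 2 := by
    funext ω
    by_cases hω : ω ∈ A
    · simp [hω, EuclideanSpace.real_norm_sq_eq, Matrix.mulVec, dotProduct]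
    · simp [hω]
  have e2 : A.indicator (fun ω => ‖a ω‖ ^ 2 + s * ‖G ω‖ ^ 2)
      = fun ω => ∑ i, (A.indicator (fun ω => a ω i) ω ^ 2
        + s * ∑ l, A.indicator (fun ω => G ω i l) ω ^ 2) := by
    funext ω
    by_cases hω : ω ∈ A
    · simp [hω, EuclideanSpace.real_norm_sq_eq, frobenius_norm_sq, Finset.sum_add_distrib,
        Finset.mul_sum]
    · simp [hω]
  rw [← integrable_indicator_iff hAm, ← integral_indicator hAm, ← integral_indicator hAm, e1, e2]
  refine ⟨integrable_finsetSum _ fun i _ => (key i).1, ?_⟩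
  rw [integral_finsetSum _ fun i _ => (key i).1, integral_finsetSum]
  · exact Finset.sum_congr rfl fun i _ => (key i).2
  · intro i _
    have hm : Measurable[past X j] fun ω => A.indicator (fun ω => a ω i) ω ^ 2
        + s * ∑ l, A.indicator (fun ω => G ω i l) ω ^ 2 :=
      (((hcoord i).indicator hA).pow_const 2).add
        ((Finset.measurable_fun_sum _ fun l _ => ((hG i l).indicator hA).pow_const 2).const_mul s)
    refine Integrable.of_bound (hm.mono (h.past_le j) le_rfl).aestronglyMeasurable
      (C ^ 2 + |s| * ∑ _l : Fin m, C ^ 2) (.of_forall fun ω => ?_)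
    rw [Real.norm_eq_abs]
    refine (abs_add_le _ _).trans (add_le_add ?_ ?_)
    · rw [abs_pow]
      exact pow_le_pow_left₀ (abs_nonneg _)
        (hle A _ (fun ω => (PiLp.norm_apply_le (a ω) i).trans (haC ω)) ω) 2
    · rw [abs_mul]
      refine mul_le_mul_of_nonneg_left ?_ (abs_nonneg s)
      rw [abs_of_nonneg (Finset.sum_nonneg fun l _ => sq_nonneg _)]
      refine Finset.sum_le_sum fun l _ => ?_
      rw [← sq_abs]
      exact pow_le_pow_left₀ (abs_nonneg _)
        (hle A _ (fun ω => (abs_entry_le_frobenius_norm (G ω) i l).trans (hGC ω)) ω) 2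

/-! ### A maximal inequality. -/

/-- Maximal inequality for a nonnegative discrete supermartingale on `{0, …, N}`. -/
theorem supermartingale_maximal {Ω : Type*} [mΩ : MeasurableSpace Ω] {P : Measure Ω}
    [IsFiniteMeasure P] {F : ℕ → MeasurableSpace Ω} (hF : Monotone F) (hFm : ∀ i, F i ≤ mΩ)
    {Z : ℕ → Ω → ℝ} (hZF : ∀ i, Measurable[F i] (Z i)) (hZ0 : ∀ i ω, 0 ≤ Z i ω)
    (hZi : ∀ i, Integrable (Z i) P) {N : ℕ}
    (hstep : ∀ i < N, ∀ A, MeasurableSet[F i] A → ∫ ω in A, Z (i + 1) ω ∂P ≤ ∫ ω in A, Z i ω ∂P)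
    (r : ℝ) : r * P.real {ω | ∃ i ≤ N, r ≤ Z i ω} ≤ ∫ ω, Z 0 ω ∂P := by
  -- `D i` says that the level was reached strictly before time `i`; hence `D (i + 1)` is `F
  -- i`-measurable, and its complement is admissible in `hstep i`.
  let D : ℕ → Set Ω := fun i => {ω | ∃ l < i, r ≤ Z l ω}
  have hS : ∀ i, MeasurableSet[F i] {ω | r ≤ Z i ω} := fun i =>
    @measurableSet_le _ _ _ _ _ (F i) _ _ _ _ _ measurable_const (hZF i)
  have hD : ∀ i, MeasurableSet[F i] (D (i + 1)) := by
    intro i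
    have : D (i + 1) = ⋃ l ∈ Finset.range (i + 1), {ω | r ≤ Z l ω} := by
      ext ω; simp [D]
    rw [this]
    refine Finset.measurableSet_biUnion _ fun l hl => ?_
    exact hF (Nat.lt_succ_iff.1 (Finset.mem_range.1 hl)) _ (hS l)
  have hDm : ∀ i, MeasurableSet (D i) := by
    rintro (_ | i)
    · simp [D]
    · exact hFm i _ (hD i)
  have hsucc : ∀ i, D (i + 1) = D i ∪ ((D i)ᶜ ∩ {ω | r ≤ Z i ω}) := by
    intro i
    ext ω
    simp only [D, Set.mem_ofPred_eq, Set.mem_union, Set.mem_inter_iff, Set.mem_compl_iff]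
    constructor
    · rintro ⟨l, hl, h⟩
      by_cases hex : ∃ l < i, r ≤ Z l ω
      · exact Or.inl hex
      · rcases Nat.lt_succ_iff_lt_or_eq.1 hl with h' | rfl
        · exact absurd ⟨l, h', h⟩ hex
        · exact Or.inr ⟨hex, h⟩
    · rintro (⟨l, hl, h⟩ | ⟨-, h⟩)
      · exact ⟨l, by omega, h⟩
      · exact ⟨i, by omega, h⟩
  -- Paths reaching the level for the first time at `i` move from the integral to the probability
  -- term; on them `r ≤ Z i`, so the total does not grow.
  have hmain : ∀ i ≤ N, r * P.real (D (i + 1)) + ∫ ω in (D (i + 1))ᶜ, Z i ω ∂P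
      ≤ r * P.real (D i) + ∫ ω in (D i)ᶜ, Z i ω ∂P := by
    intro i _
    have hT : MeasurableSet ((D i)ᶜ ∩ {ω | r ≤ Z i ω}) := (hDm i).compl.inter (hFm i _ (hS i))
    have h1 : P.real (D (i + 1)) = P.real (D i) + P.real ((D i)ᶜ ∩ {ω | r ≤ Z i ω}) := by
      rw [hsucc]
      exact measureReal_union (Set.disjoint_left.2 fun ω h h' => h'.1 h) hT
    have h2 : (D i)ᶜ = (D (i + 1))ᶜ ∪ ((D i)ᶜ ∩ {ω | r ≤ Z i ω}) := by
      rw [hsucc]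
      ext ω
      by_cases h : ω ∈ D i <;> simp [h, lt_or_ge]
    have h3 : ∫ ω in (D i)ᶜ, Z i ω ∂P = ∫ ω in (D (i + 1))ᶜ, Z i ω ∂P
        + ∫ ω in (D i)ᶜ ∩ {ω | r ≤ Z i ω}, Z i ω ∂P := by
      conv_lhs => rw [h2]
      refine setIntegral_union (Set.disjoint_left.2 fun ω h h' => h ?_) hT (hZi i).integrableOn
        (hZi i).integrableOn
      rw [hsucc]; exact Or.inr h'
    have h4 : r * P.real ((D i)ᶜ ∩ {ω | r ≤ Z i ω})
        ≤ ∫ ω in (D i)ᶜ ∩ {ω | r ≤ Z i ω}, Z i ω ∂P := by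
      have := setIntegral_mono_on (μ := P) (f := fun _ => r) (g := Z i)
        (integrable_const r).integrableOn (hZi i).integrableOn hT fun ω h => h.2
      rwa [setIntegral_const, smul_eq_mul, mul_comm] at this
    rw [h1, h3, mul_add]
    linarith
  have hall : ∀ i ≤ N, r * P.real (D i) + ∫ ω in (D i)ᶜ, Z i ω ∂P ≤ ∫ ω, Z 0 ω ∂P := by
    intro i
    induction i with
    | zero => intro _; simp [D]
    | succ i ih =>
      intro hi
      have a1 := hmain i (by omega)
      have a2 := hstep i (by omega) _ (@MeasurableSet.compl _ _ (F i) (hD i))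
      have a3 := ih (by omega)
      linarith
  have hfin := (hmain N le_rfl).trans (hall N le_rfl)
  have hnn : 0 ≤ ∫ ω in (D (N + 1))ᶜ, Z N ω ∂P := integral_nonneg fun ω => hZ0 N ω
  have hset : {ω | ∃ i ≤ N, r ≤ Z i ω} = D (N + 1) := by
    ext ω; simp [D]
  rw [hset]
  linarith

/-! ### Brownian increments as white noise. -/

/-- The increments of a Brownian motion over a uniform grid. -/
noncomputable def incr {Ω : Type*} {m : ℕ} (W : ℝ≥0 → Ω → E m) (Δ : ℝ) (p : Fin m × ℕ) (ω : Ω) :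
    ℝ :=
  W (((p.2 : ℝ) + 1) * Δ).toNNReal ω p.1 - W ((p.2 : ℝ) * Δ).toNNReal ω p.1

theorem IsBrownianMotion.isWhiteNoise_incr {Ω : Type*} [MeasurableSpace Ω] {P : Measure Ω}
    [IsProbabilityMeasure P] {m : ℕ} {W : ℝ≥0 → Ω → E m} (hW : IsBrownianMotion P W) {Δ : ℝ}
    (hΔ : 0 ≤ Δ) : IsWhiteNoise P (incr W Δ) Δ := by
  have hmeas : ∀ p, Measurable (incr W Δ p) := fun p => by
    have h1 := hW.measurable (((p.2 : ℝ) + 1) * Δ).toNNReal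
    have h2 := hW.measurable ((p.2 : ℝ) * Δ).toNNReal
    unfold incr
    fun_prop
  have hlaw : ∀ p, HasLaw (incr W Δ p) (gaussianReal 0 Δ.toNNReal) P := by
    intro p
    have h := (hW.coord p.1).toIsPreBrownianReal.hasLaw_sub (((p.2 : ℝ) + 1) * Δ).toNNReal
      ((p.2 : ℝ) * Δ).toNNReal
    convert h using 1
    · rfl
    refine congrArg (gaussianReal 0) (NNReal.eq ?_)
    change (Δ.toNNReal : ℝ) = |((((p.2 : ℝ) + 1) * Δ).toNNReal : ℝ) - (((p.2 : ℝ) * Δ).toNNReal : ℝ)|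
    rw [Real.coe_toNNReal _ hΔ, Real.coe_toNNReal _ (by positivity),
      Real.coe_toNNReal _ (by positivity)]
    rw [show ((p.2 : ℝ) + 1) * Δ - p.2 * Δ = Δ by ring, abs_of_nonneg hΔ]
  have hmean : ∀ p, ∫ ω, incr W Δ p ω ∂P = 0 := fun p => by
    rw [(hlaw p).integral_eq, integral_id_gaussianReal]
  refine ⟨hmeas, fun p => (hlaw p).hasGaussianLaw.memLp_two, hmean, fun p => ?_, ?_⟩
  · have h := (hlaw p).variance_eq
    rw [variance_of_integral_eq_zero (hmeas p).aemeasurable (hmean p),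
      variance_id_gaussianReal, Real.coe_toNNReal _ hΔ] at h
    simpa only [Pi.pow_apply, pow_two] using h
  -- Joint independence in two layers: whole coordinate processes are independent of each other, and
  -- within one coordinate the increments over the grid are independent.
  · refine iIndepFun_uncurry' (X := fun (l : Fin m) (j : ℕ) => incr W Δ (l, j))
      (fun l j => hmeas (l, j)) ?_ fun l => ?_
    · have h := hW.indep.comp (fun (_ : Fin m) (w : ℝ≥0 → ℝ) (j : ℕ) =>
        w (((j : ℝ) + 1) * Δ).toNNReal - w ((j : ℝ) * Δ).toNNReal)
        (fun _ => measurable_pi_lambda _ fun j => by fun_prop)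
      exact h
    · have h := (hW.coord l).toIsPreBrownianReal.hasIndepIncrements.nat
        (t := fun j : ℕ => ((j : ℝ) * Δ).toNNReal)
        (fun i j hij => Real.toNNReal_le_toNNReal (by gcongr))
      convert h using 4
      simp [incr]

/-! ### Delay difference inequalities. -/

/-- The Lyapunov functional of a delay difference inequality: the value at time `n + N` plus the
weighted values over the preceding window of length `N`. -/
def windowEnergy (N : ℕ) (Δ c b : ℝ) (x v : ℕ → ℝ) (n : ℕ) : ℝ :=
  x (n + N) + Δ * ∑ i ∈ Finset.range N, (c * x (n + i) + b * v (n + i))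

section DelayDifferenceInequality

variable {N : ℕ} {Δ c₁ c₂ b₃ b₄ : ℝ} {x v : ℕ → ℝ}

theorem windowEnergy_nonneg (hΔ : 0 ≤ Δ) (hc₂ : 0 ≤ c₂) (hb₄ : 0 ≤ b₄) (hx : ∀ n, 0 ≤ x n)
    (hv : ∀ n, 0 ≤ v n) (n : ℕ) : 0 ≤ windowEnergy N Δ c₂ b₄ x v n :=
  add_nonneg (hx _) (mul_nonneg hΔ (Finset.sum_nonneg fun _ _ =>
    add_nonneg (mul_nonneg hc₂ (hx _)) (mul_nonneg hb₄ (hv _))))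

/-- Shifting the window drops the term at `n`, which pays exactly for the delayed forcing, and adds
the term at `n + N`, which uses up part of the dissipation. The differences `c₁ - c₂` and `b₃ - b₄`
remain. -/
theorem windowEnergy_succ_le
    (h : ∀ n, x (n + N + 1) ≤ x (n + N)
      + Δ * (-c₁ * x (n + N) + c₂ * x n - b₃ * v (n + N) + b₄ * v n)) (n : ℕ) :
    windowEnergy N Δ c₂ b₄ x v (n + 1)
        + Δ * ((c₁ - c₂) * x (n + N) + (b₃ - b₄) * v (n + N))
      ≤ windowEnergy N Δ c₂ b₄ x v n := by
  have e : ∑ i ∈ Finset.range N, (c₂ * x (n + 1 + i) + b₄ * v (n + 1 + i))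
      = ∑ i ∈ Finset.range N, (c₂ * x (n + i) + b₄ * v (n + i))
        + (c₂ * x (n + N) + b₄ * v (n + N)) - (c₂ * x n + b₄ * v n) := by
    have h1 := Finset.sum_range_succ (fun i => c₂ * x (n + i) + b₄ * v (n + i)) N
    have h2 := Finset.sum_range_succ' (fun i => c₂ * x (n + i) + b₄ * v (n + i)) N
    have h3 : ∀ i, n + 1 + i = n + (i + 1) := fun i => by omega
    simp only [h3]
    rw [h1] at h2
    simp only [add_zero] at h2
    linarith
  have h4 := h n
  unfold windowEnergy
  rw [e, show n + 1 + N = n + N + 1 by omega]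
  linarith

/-- Every lag `i ≤ N` sums over a subset of the indices below `N + n`. This compares a sum at any
lag with the initial window plus the sum at lag `N`, the one the dissipation controls. -/
theorem sum_range_add_le {w : ℕ → ℝ} (hw : ∀ n, 0 ≤ w n) {i : ℕ} (hi : i ≤ N) (n : ℕ) :
    ∑ j ∈ Finset.range n, w (j + i)
      ≤ ∑ j ∈ Finset.range N, w j + ∑ j ∈ Finset.range n, w (j + N) := by
  have h1 : ∑ j ∈ Finset.range (N + n), w j
      = ∑ j ∈ Finset.range N, w j + ∑ j ∈ Finset.range n, w (j + N) := by
    rw [Finset.sum_range_add]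
    simp only [add_comm]
  have h2 : ∑ j ∈ Finset.range (i + n), w j
      = ∑ j ∈ Finset.range i, w j + ∑ j ∈ Finset.range n, w (j + i) := by
    rw [Finset.sum_range_add]
    simp only [add_comm]
  have h3 : ∑ j ∈ Finset.range (i + n), w j ≤ ∑ j ∈ Finset.range (N + n), w j :=
    Finset.sum_le_sum_of_subset_of_nonneg (Finset.range_mono (by omega)) fun j _ _ => hw j
  have h4 : 0 ≤ ∑ j ∈ Finset.range i, w j := Finset.sum_nonneg fun j _ => hw j
  linarith

/-- Solutions of a contractive delay difference inequality lose their energy at a rate which does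
not depend on the step size. -/
theorem mul_windowEnergy_le {κ κ' : ℝ} (hΔ : 0 ≤ Δ) (hκ : 0 < κ) (hκ' : 0 < κ')
    (hc : κ ≤ c₁ - c₂) (hb : κ' ≤ b₃ - b₄) (hc₂ : 0 ≤ c₂) (hb₄ : 0 ≤ b₄)
    (hx : ∀ n, 0 ≤ x n) (hv : ∀ n, 0 ≤ v n)
    (h : ∀ n, x (n + N + 1) ≤ x (n + N)
      + Δ * (-c₁ * x (n + N) + c₂ * x n - b₃ * v (n + N) + b₄ * v n)) (n : ℕ) :
    n * Δ * windowEnergy N Δ c₂ b₄ x v n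
      ≤ (1 / κ + N * Δ * (1 + c₂ / κ + b₄ / κ')) * windowEnergy N Δ c₂ b₄ x v 0 := by
  set L := windowEnergy N Δ c₂ b₄ x v with hL
  have hL0 : ∀ n, 0 ≤ L n := windowEnergy_nonneg hΔ hc₂ hb₄ hx hv
  have hsucc := windowEnergy_succ_le h
  have hstep : ∀ n, L (n + 1) + Δ * (κ * x (n + N) + κ' * v (n + N)) ≤ L n := fun n => by
    refine le_trans (add_le_add le_rfl (mul_le_mul_of_nonneg_left ?_ hΔ)) (hsucc n)
    exact add_le_add (mul_le_mul_of_nonneg_right hc (hx _)) (mul_le_mul_of_nonneg_right hb (hv _))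
  have hanti : Antitone L := antitone_nat_of_succ_le fun n => by
    have h1 := hstep n
    have h2 := hx (n + N)
    have h3 := hv (n + N)
    have : 0 ≤ Δ * (κ * x (n + N) + κ' * v (n + N)) := by positivity
    linarith
  have hsum : ∀ n, L n + Δ * (κ * ∑ j ∈ Finset.range n, x (j + N)
      + κ' * ∑ j ∈ Finset.range n, v (j + N)) ≤ L 0 := by
    intro n
    induction n with
    | zero => simp
    | succ n ih =>
      rw [Finset.sum_range_succ, Finset.sum_range_succ]
      have := hstep n
      linarith
  have hsx : Δ * ∑ j ∈ Finset.range n, x (j + N) ≤ L 0 / κ := by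
    rw [le_div_iff₀ hκ]
    have h1 := hsum n
    have h2 := hL0 n
    have h3 : 0 ≤ Δ * (κ' * ∑ j ∈ Finset.range n, v (j + N)) :=
      mul_nonneg hΔ (mul_nonneg hκ'.le (Finset.sum_nonneg fun j _ => hv _))
    linarith
  have hsv : Δ * ∑ j ∈ Finset.range n, v (j + N) ≤ L 0 / κ' := by
    rw [le_div_iff₀ hκ']
    have h1 := hsum n
    have h2 := hL0 n
    have h3 : 0 ≤ Δ * (κ * ∑ j ∈ Finset.range n, x (j + N)) :=
      mul_nonneg hΔ (mul_nonneg hκ.le (Finset.sum_nonneg fun j _ => hx _))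
    linarith
  have hinit : Δ * ∑ j ∈ Finset.range N, (c₂ * x j + b₄ * v j) ≤ L 0 := by
    simp only [hL, windowEnergy, zero_add]
    linarith [hx N]
  -- For each lag, the initial window costs at most one `L 0`, and the rest is bounded by the
  -- dissipated sums `hsx` and `hsv`. Summing over the `N` lags with weight `Δ` produces the factor
  -- `N * Δ`, which is the delay and not a step-dependent quantity.
  have hw : ∀ i ∈ Finset.range N, Δ * ∑ j ∈ Finset.range n, (c₂ * x (j + i) + b₄ * v (j + i))
      ≤ (1 + c₂ / κ + b₄ / κ') * L 0 := by
    intro i hi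
    have h1 := sum_range_add_le (w := fun j => c₂ * x j + b₄ * v j)
      (fun j => add_nonneg (mul_nonneg hc₂ (hx _)) (mul_nonneg hb₄ (hv _)))
      (Finset.mem_range.1 hi).le n
    have h2 := mul_le_mul_of_nonneg_left h1 hΔ
    rw [mul_add] at h2
    have h3 : Δ * ∑ j ∈ Finset.range n, (c₂ * x (j + N) + b₄ * v (j + N))
        = c₂ * (Δ * ∑ j ∈ Finset.range n, x (j + N))
          + b₄ * (Δ * ∑ j ∈ Finset.range n, v (j + N)) := by
      rw [Finset.sum_add_distrib, ← Finset.mul_sum, ← Finset.mul_sum]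
      ring
    have h4 : c₂ * (Δ * ∑ j ∈ Finset.range n, x (j + N)) ≤ c₂ * (L 0 / κ) :=
      mul_le_mul_of_nonneg_left hsx hc₂
    have h5 := mul_le_mul_of_nonneg_left hsv hb₄
    calc _ ≤ L 0 + (c₂ * (L 0 / κ) + b₄ * (L 0 / κ')) := by linarith
      _ = _ := by ring
  have htot : Δ * ∑ j ∈ Finset.range n, L j
      ≤ (1 / κ + N * Δ * (1 + c₂ / κ + b₄ / κ')) * L 0 := by
    have e : Δ * ∑ j ∈ Finset.range n, L j = Δ * ∑ j ∈ Finset.range n, x (j + N)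
        + Δ * ∑ i ∈ Finset.range N,
          Δ * ∑ j ∈ Finset.range n, (c₂ * x (j + i) + b₄ * v (j + i)) := by
      simp only [hL, windowEnergy]
      rw [Finset.sum_add_distrib, ← Finset.mul_sum, ← Finset.mul_sum, Finset.sum_comm, mul_add]
    have h1 := mul_le_mul_of_nonneg_left (Finset.sum_le_sum hw) hΔ
    rw [Finset.sum_const, Finset.card_range, nsmul_eq_mul] at h1
    rw [e]
    calc _ ≤ L 0 / κ + Δ * (N * ((1 + c₂ / κ + b₄ / κ') * L 0)) := add_le_add hsx h1
      _ = _ := by ring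
  refine le_trans ?_ htot
  -- Since `L` decreases, its last value is at most its average; this turns summability into the
  -- rate `1 / (n Δ)`.
  have h1 : ∑ _j ∈ Finset.range n, L n ≤ ∑ j ∈ Finset.range n, L j :=
    Finset.sum_le_sum fun j hj => hanti (Finset.mem_range.1 hj).le
  rw [Finset.sum_const, Finset.card_range, nsmul_eq_mul] at h1
  calc n * Δ * L n = Δ * (n * L n) := by ring
    _ ≤ _ := mul_le_mul_of_nonneg_left h1 hΔ

end DelayDifferenceInequality

/-! ### Truncation as a projection. -/

section Truncation

variable {d : ℕ} (ρ : Set.Ici (1 : ℝ))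

theorem level_pos : (0 : ℝ) < ρ := zero_lt_one.trans_le ρ.2

theorem norm_trunc (x : E d) : ‖trunc ρ x‖ = min ‖x‖ ρ := by
  by_cases hx : x = 0
  · subst hx; simp [trunc, (level_pos ρ).le]
  · rw [trunc, norm_smul, norm_smul, norm_inv, norm_norm,
      inv_mul_cancel₀ (norm_ne_zero_iff.2 hx), mul_one,
      Real.norm_of_nonneg (le_min (norm_nonneg x) (level_pos ρ).le)]

/-- The truncation is the metric projection onto a ball: its variational characterization. -/
theorem inner_sub_trunc_nonneg (x y : E d) :
    0 ≤ inner ℝ (x - trunc ρ x) (trunc ρ x - trunc ρ y) := by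
  rcases le_or_gt ‖x‖ ρ with h | h
  · have : trunc ρ x = x := by
      by_cases hx : x = 0
      · subst hx; simp [trunc]
      · rw [trunc, min_eq_left h, smul_smul, mul_inv_cancel₀ (norm_ne_zero_iff.2 hx), one_smul]
    rw [this, sub_self, inner_zero_left]
  · have hρ := level_pos ρ
    have hx : 0 < ‖x‖ := hρ.trans h
    have hT : trunc ρ x = ((ρ : ℝ) * ‖x‖⁻¹) • x := by rw [trunc, min_eq_right h.le, smul_smul]
    -- Outside the ball the residual is a nonnegative multiple of the projected point, so the claim
    -- reduces to Cauchy-Schwarz against a vector of norm at most `ρ`.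
    have hd : x - trunc ρ x = (‖x‖ / ρ - 1) • trunc ρ x := by
      have : (‖x‖ / ρ - 1) * ((ρ : ℝ) * ‖x‖⁻¹) = 1 - (ρ : ℝ) * ‖x‖⁻¹ := by field_simp
      rw [hT, smul_smul, this, sub_smul, one_smul]
    have hnx : ‖trunc ρ x‖ = ρ := by rw [norm_trunc, min_eq_right h.le]
    have hny : ‖trunc ρ y‖ ≤ ρ := by rw [norm_trunc]; exact min_le_right _ _
    rw [hd, inner_smul_left, inner_sub_right, real_inner_self_eq_norm_sq, hnx]
    have h1 := real_inner_le_norm (trunc ρ x) (trunc ρ y)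
    rw [hnx] at h1
    have h2 : (ρ : ℝ) * ‖trunc ρ y‖ ≤ ρ * ρ := mul_le_mul_of_nonneg_left hny hρ.le
    refine mul_nonneg ?_ (by nlinarith)
    have h3 : 1 ≤ ‖x‖ / ρ := (one_le_div hρ).2 h.le
    simpa using h3

/-- Adding the variational inequalities at `x` and at `y` gives `‖a - b‖² ≤ ⟪x - y, a - b⟫`; then
apply Cauchy-Schwarz and cancel. -/
theorem norm_trunc_sub_trunc_le (x y : E d) : ‖trunc ρ x - trunc ρ y‖ ≤ ‖x - y‖ := by
  have h1 := inner_sub_trunc_nonneg ρ x y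
  have h2 := inner_sub_trunc_nonneg ρ y x
  set a := trunc ρ x
  set b := trunc ρ y
  have h3 : inner ℝ (x - y) (a - b)
      = inner ℝ (x - a) (a - b) + inner ℝ (y - b) (b - a) + ‖a - b‖ ^ 2 := by
    rw [← real_inner_self_eq_norm_sq]
    simp only [inner_sub_left, inner_sub_right]
    ring
  have h4 := real_inner_le_norm (x - y) (a - b)
  rcases (norm_nonneg (a - b)).eq_or_lt with h | h
  · rw [← h]; exact norm_nonneg _
  · refine le_of_mul_le_mul_right ?_ h
    nlinarith

end Truncation

/-! ### Consequences of the assumptions on the coefficients. -/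

theorem continuous_of_locally_lipschitz {d : ℕ} {F : Type*} [SeminormedAddCommGroup F]
    {φ : E d → E d → F}
    (h : ∀ R : ℝ, 0 < R → ∃ ℓ : ℝ, ∀ x x' y y' : E d, ‖x‖ ≤ R → ‖x'‖ ≤ R → ‖y‖ ≤ R → ‖y'‖ ≤ R →
      ‖φ x y - φ x' y'‖ ≤ ℓ * (‖x - x'‖ + ‖y - y'‖)) :
    Continuous fun p : E d × E d => φ p.1 p.2 := by
  rw [continuous_iff_continuousAt]
  intro p
  obtain ⟨ℓ, hℓ⟩ := h (‖p‖ + 1) (by positivity)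
  rw [ContinuousAt, tendsto_iff_norm_sub_tendsto_zero]
  have hlim : Filter.Tendsto (fun q : E d × E d => ℓ * (‖q.1 - p.1‖ + ‖q.2 - p.2‖)) (nhds p)
      (nhds 0) := by
    have : Continuous fun q : E d × E d => ℓ * (‖q.1 - p.1‖ + ‖q.2 - p.2‖) := by fun_prop
    simpa using this.tendsto p
  refine squeeze_zero' (.of_forall fun q => norm_nonneg _) ?_ hlim
  filter_upwards [Metric.ball_mem_nhds p one_pos] with q hq
  have hq' : ‖q‖ ≤ ‖p‖ + 1 := by
    have h1 : ‖q - p‖ < 1 := by rwa [Metric.mem_ball, dist_eq_norm] at hq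
    have h2 := norm_le_norm_add_norm_sub' q p
    linarith
  exact hℓ _ _ _ _ ((norm_fst_le q).trans hq') ((norm_fst_le p).trans (by linarith))
    ((norm_snd_le q).trans hq') ((norm_snd_le p).trans (by linarith))

section Coefficients

variable {d m : ℕ} {f : E d → E d → E d} {g : E d → E d → Matrix (Fin d) (Fin m) ℝ}

theorem H1.continuous_drift (h : H1 f g) : Continuous fun p : E d × E d => f p.1 p.2 :=
  continuous_of_locally_lipschitz fun R hR =>
    let ⟨ℓ, _, hℓ⟩ := h R hR
    ⟨ℓ, fun x x' y y' a b c e => (le_max_left _ _).trans (hℓ x x' y y' a b c e)⟩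

theorem H1.continuous_diffusion (h : H1 f g) (i : Fin d) (l : Fin m) :
    Continuous fun p : E d × E d => g p.1 p.2 i l :=
  continuous_of_locally_lipschitz (φ := fun x y => g x y i l) fun R hR =>
    let ⟨ℓ, _, hℓ⟩ := h R hR
    ⟨ℓ, fun x x' y y' a b c e => (abs_entry_le_frobenius_norm (g x y - g x' y') i l).trans
      ((le_max_right _ _).trans (hℓ x x' y y' a b c e))⟩

variable {Φ : Set.Ici (1 : ℝ) → ℝ}

theorem one_le_constK : 1 ≤ constK f g Φ := le_max_left _ _

/-- Intermediate value theorem on the connected set `[1, ∞)`: the target is at least `Φ 1` because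
`K ≥ Φ 1` and `Δ ^ (-ν) ≥ 1`, and `Φ` is unbounded above. -/
theorem IsControl.apply_level (hΦ : IsControl f g Φ) {ν Δ : ℝ} (hν : 0 ≤ ν)
    (hΔ : Δ ∈ Set.Ioc (0 : ℝ) 1) : Φ (level f g Φ ν Δ) = constK f g Φ * Δ ^ (-ν) := by
  refine Function.invFun_eq ?_
  have hK : Φ ⟨1, Set.self_mem_Ici⟩ ≤ constK f g Φ :=
    (le_max_left _ _).trans (le_max_right _ _)
  have hone : 1 ≤ Δ ^ (-ν) :=
    Real.one_le_rpow_of_pos_of_le_one_of_nonpos hΔ.1 hΔ.2 (neg_nonpos.2 hν)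
  have hle : Φ ⟨1, Set.self_mem_Ici⟩ ≤ constK f g Φ * Δ ^ (-ν) :=
    hK.trans (le_mul_of_one_le_right (zero_le_one.trans one_le_constK) hone)
  obtain ⟨R, hR⟩ := (hΦ.tendsto.eventually_ge_atTop (constK f g Φ * Δ ^ (-ν))).exists
  have : PreconnectedSpace (Set.Ici (1 : ℝ)) := Subtype.preconnectedSpace isPreconnected_Ici
  exact mem_range_of_exists_le_of_exists_ge hΦ.continuous ⟨_, hle⟩ ⟨R, hR⟩

theorem IsControl.norm_sub_le (hΦ : IsControl f g Φ) (R : Set.Ici (1 : ℝ)) {x x' y y' : E d}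
    (hx : ‖x‖ ≤ R) (hx' : ‖x'‖ ≤ R) (hy : ‖y‖ ≤ R) (hy' : ‖y'‖ ≤ R) :
    ‖f x y - f x' y'‖ ≤ Φ R * (‖x - x'‖ + ‖y - y'‖) := by
  have hmin : 0 ≤ min 1 ‖y - y'‖ := le_min zero_le_one (norm_nonneg _)
  have hden : 0 ≤ ‖x - x'‖ + min 1 ‖y - y'‖ := add_nonneg (norm_nonneg _) hmin
  rcases hden.eq_or_lt with h | h
  · have h1 : ‖x - x'‖ = 0 := by linarith [norm_nonneg (x - x')]
    have h2 : min 1 ‖y - y'‖ = 0 := by linarith [norm_nonneg (x - x')]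
    have h3 : ‖y - y'‖ = 0 := by
      rcases min_choice 1 ‖y - y'‖ with h' | h' <;> rw [h'] at h2
      · norm_num at h2
      · exact h2
    rw [norm_eq_zero, sub_eq_zero] at h1 h3
    subst h1 h3
    simp
  · have h1 := hΦ.bound R x x' y y' hx hx' hy hy'
    have h2 : ‖f x y - f x' y'‖ / (‖x - x'‖ + min 1 ‖y - y'‖) ≤ Φ R :=
      le_trans (le_add_of_nonneg_right (by positivity)) h1
    rw [div_le_iff₀ h] at h2
    refine h2.trans (mul_le_mul_of_nonneg_left ?_ (hΦ.nonneg R))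
    exact add_le_add le_rfl (min_le_right _ _)

/-- One explicit Euler step contracts, up to the delayed terms. -/
theorem H3.euler_step_le {b₁ b₂ b₃ b₄ : ℝ} {V : E d → E d → ℝ} (h3 : H3 f g b₁ b₂ b₃ b₄ V)
    (hΦ : IsControl f g Φ) (R : Set.Ici (1 : ℝ)) {Δ q : ℝ} (hΔ : 0 ≤ Δ) (hq : Φ R ^ 2 * Δ ≤ q)
    {x x' y y' : E d} (hx : ‖x‖ ≤ R) (hx' : ‖x'‖ ≤ R) (hy : ‖y‖ ≤ R) (hy' : ‖y'‖ ≤ R) :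
    ‖x - x' + Δ • (f x y - f x' y')‖ ^ 2 + Δ * ‖g x y - g x' y'‖ ^ 2
      ≤ ‖x - x'‖ ^ 2 + Δ * (-(b₁ - 2 * q) * ‖x - x'‖ ^ 2 + (b₂ + 2 * q) * ‖y - y'‖ ^ 2
        - b₃ * V x x' + b₄ * V y y') := by
  have h1 := mul_le_mul_of_nonneg_left (h3.bound x x' y y') hΔ
  have h2 := hΦ.norm_sub_le R hx hx' hy hy'
  have h4 : ‖f x y - f x' y'‖ ^ 2 ≤ Φ R ^ 2 * (2 * (‖x - x'‖ ^ 2 + ‖y - y'‖ ^ 2)) := by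
    refine (pow_le_pow_left₀ (norm_nonneg _) h2 2).trans ?_
    rw [mul_pow]
    exact mul_le_mul_of_nonneg_left add_sq_le (sq_nonneg _)
  -- The squared drift increment is the only term not covered by (H3). One factor `Δ` is spent on
  -- turning `Φ R ^ 2` into `q`, the other stays as the step.
  have h5 : Δ * (Δ * ‖f x y - f x' y'‖ ^ 2) ≤ Δ * (q * (2 * (‖x - x'‖ ^ 2 + ‖y - y'‖ ^ 2))) := by
    refine mul_le_mul_of_nonneg_left ?_ hΔ
    calc _ ≤ Δ * (Φ R ^ 2 * (2 * (‖x - x'‖ ^ 2 + ‖y - y'‖ ^ 2))) :=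
          mul_le_mul_of_nonneg_left h4 hΔ
      _ = Φ R ^ 2 * Δ * (2 * (‖x - x'‖ ^ 2 + ‖y - y'‖ ^ 2)) := by ring
      _ ≤ _ := mul_le_mul_of_nonneg_right hq (by positivity)
  rw [norm_add_sq_real, inner_smul_right, norm_smul, Real.norm_of_nonneg hΔ, mul_pow]
  linarith

end Coefficients

/-! ### Bounds and adaptedness of the scheme. -/

section Scheme

variable {d m : ℕ} {f : E d → E d → E d} {g : E d → E d → Matrix (Fin d) (Fin m) ℝ}
  {ρ : Set.Ici (1 : ℝ)} {τ : ℝ} {hτ : 0 < τ} {Δ : ℝ} {N : ℕ}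

theorem norm_u_le_level (ξ : Seg d τ) (w : ℝ≥0 → E m) (k : ℤ) :
    ‖u f g ρ hτ Δ N ξ w k‖ ≤ ρ := by
  rw [u, norm_trunc]; exact min_le_right _ _

theorem norm_u_le_norm (ξ : Seg d τ) (w : ℝ≥0 → E m) {k : ℤ} (hk : k ≤ 0) :
    ‖u f g ρ hτ Δ N ξ w k‖ ≤ ‖ξ‖ := by
  rw [u, norm_trunc, breveU, if_pos hk]
  exact (min_le_left _ _).trans (ξ.norm_coe_le_norm _)

theorem breveU_succ {Ω : Type*} (ξ : Seg d τ) (W : ℝ≥0 → Ω → E m) (ω : Ω) (j : ℕ) :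
    breveU f g ρ hτ Δ N ξ (fun t => W t ω) ((j : ℤ) + 1)
      = u f g ρ hτ Δ N ξ (fun t => W t ω) j
        + Δ • f (u f g ρ hτ Δ N ξ (fun t => W t ω) j) (u f g ρ hτ Δ N ξ (fun t => W t ω) (j - N))
        + WithLp.toLp 2 (g (u f g ρ hτ Δ N ξ (fun t => W t ω) j)
          (u f g ρ hτ Δ N ξ (fun t => W t ω) (j - N)) *ᵥ fun l => incr W Δ (l, j) ω) := by
  rw [breveU, if_neg (by omega)]
  simp only [add_sub_cancel_right, u]
  congr 3
  funext l
  simp [incr]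

/-- Induction on `n`: the iterate at `n + 1` uses the noise with index `n`, which belongs to the
past of `n + 1`. Quantifying over all `k ≤ n` makes the delayed iterate available too. -/
theorem measurable_u {Ω : Type*} (h1 : H1 f g) (ξ : Seg d τ) (W : ℝ≥0 → Ω → E m) (n : ℕ) :
    ∀ k : ℤ, k ≤ n → Measurable[past (incr W Δ) n]
      fun ω => u f g ρ hτ Δ N ξ (fun t => W t ω) k := by
  induction n with
  | zero =>
    intro k hk
    have : (fun ω => u f g ρ hτ Δ N ξ (fun t => W t ω) k)
        = fun _ => trunc ρ (evalAt hτ ξ ((k : ℝ) * Δ)) := by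
      funext ω
      rw [u, breveU, if_pos (by exact_mod_cast hk)]
    rw [this]
    exact measurable_const
  | succ n ih =>
    intro k hk
    rcases lt_or_eq_of_le hk with hk' | rfl
    · exact (ih k (by push_cast at hk'; omega)).mono (past_mono _ n.le_succ) le_rfl
    · have hu := (ih n le_rfl).mono (past_mono _ n.le_succ) le_rfl
      have hud := (ih (n - N) (by omega)).mono (past_mono _ n.le_succ) le_rfl
      refine (continuous_trunc ρ).measurable.comp ?_
      push_cast
      simp only [breveU_succ]
      refine (hu.add ((h1.continuous_drift.measurable.comp (hu.prodMk hud)).const_smul Δ)).add ?_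
      refine (WithLp.measurable_toLp 2 (Fin d → ℝ)).comp ?_
      refine @measurable_pi_lambda _ _ _ (past (incr W Δ) (n + 1)) _ _ fun i => ?_
      exact Finset.measurable_fun_sum Finset.univ fun l _ =>
        ((h1.continuous_diffusion i l).measurable.comp (hu.prodMk hud)).mul
          (measurable_past (incr W Δ) (p := (l, n)) n.lt_succ_self)

end Scheme

/-- Compactness of closed balls. With radius `ρ` this gives integrability along the scheme; with
radius `M` it bounds the initial energy independently of the step. -/
theorem IsHatC.exists_bound {d : ℕ} {V : E d → E d → ℝ} (hV : IsHatC V) (R : ℝ) :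
    ∃ S : ℝ, 0 ≤ S ∧ ∀ x y : E d, ‖x‖ ≤ R → ‖y‖ ≤ R → V x y ≤ S := by
  obtain ⟨S, hS⟩ := ((isCompact_closedBall (0 : E d) R).prod
    (isCompact_closedBall (0 : E d) R)).bddAbove_image hV.continuous.continuousOn
  refine ⟨max S 0, le_max_right _ _, fun x y hx hy => le_max_of_le_left (hS ⟨(x, y), ?_, rfl⟩)⟩
  exact ⟨by simpa using hx, by simpa using hy⟩

/-! ### Evolution of the error between two runs. -/

section Error

variable {Ω : Type*} {d m : ℕ} (f : E d → E d → E d) (g : E d → E d → Matrix (Fin d) (Fin m) ℝ)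
  (ρ : Set.Ici (1 : ℝ)) {τ : ℝ} (hτ : 0 < τ) (Δ : ℝ) (N : ℕ) (ξ ζ : Seg d τ)
  (W : ℝ≥0 → Ω → E m)

/-- The squared distance of two truncated iterates driven by the same noise. -/
noncomputable def errSq (k : ℤ) (ω : Ω) : ℝ :=
  ‖u f g ρ hτ Δ N ξ (fun t => W t ω) k - u f g ρ hτ Δ N ζ (fun t => W t ω) k‖ ^ 2

/-- A function of two variables along two truncated iterates driven by the same noise. -/
noncomputable def errV (V : E d → E d → ℝ) (k : ℤ) (ω : Ω) : ℝ :=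
  V (u f g ρ hτ Δ N ξ (fun t => W t ω) k) (u f g ρ hτ Δ N ζ (fun t => W t ω) k)

variable {f g ρ hτ Δ N ξ ζ W}

theorem measurable_errV (h1 : H1 f g) {V : E d → E d → ℝ}
    (hV : Continuous fun p : E d × E d => V p.1 p.2) {n : ℕ} {k : ℤ} (hk : k ≤ n) :
    Measurable[past (incr W Δ) n] (errV f g ρ hτ Δ N ξ ζ W V k) :=
  hV.measurable.comp ((measurable_u h1 ξ W n k hk).prodMk (measurable_u h1 ζ W n k hk))

theorem measurable_errSq (h1 : H1 f g) {n : ℕ} {k : ℤ} (hk : k ≤ n) :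
    Measurable[past (incr W Δ) n] (errSq f g ρ hτ Δ N ξ ζ W k) :=
  measurable_errV (f := f) (g := g) (ρ := ρ) (hτ := hτ) (N := N) (ξ := ξ) (ζ := ζ)
    (V := fun x y => ‖x - y‖ ^ 2) h1 (by fun_prop) hk

theorem errSq_nonneg (k : ℤ) (ω : Ω) : 0 ≤ errSq f g ρ hτ Δ N ξ ζ W k ω := sq_nonneg _

variable [MeasurableSpace Ω] {P : Measure Ω} [IsProbabilityMeasure P] {s : ℝ}

theorem integrable_errSq (hX : IsWhiteNoise P (incr W Δ) s) (h1 : H1 f g) (k : ℤ) :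
    Integrable (errSq f g ρ hτ Δ N ξ ζ W k) P := by
  refine Integrable.of_bound ((measurable_errSq h1 (Int.self_le_toNat k)).mono
    (hX.past_le _) le_rfl).aestronglyMeasurable ((ρ + ρ : ℝ) ^ 2) (.of_forall fun ω => ?_)
  rw [Real.norm_of_nonneg (errSq_nonneg k ω)]
  exact pow_le_pow_left₀ (norm_nonneg _)
    ((norm_sub_le _ _).trans (add_le_add (norm_u_le_level _ _ _) (norm_u_le_level _ _ _))) 2

theorem integrable_errV (hX : IsWhiteNoise P (incr W Δ) s) (h1 : H1 f g) {V : E d → E d → ℝ}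
    (hV : IsHatC V) (k : ℤ) : Integrable (errV f g ρ hτ Δ N ξ ζ W V k) P := by
  obtain ⟨S, -, hS⟩ := hV.exists_bound ρ
  refine Integrable.of_bound ((measurable_errV h1 hV.continuous (Int.self_le_toNat k)).mono
    (hX.past_le _) le_rfl).aestronglyMeasurable S (.of_forall fun ω => ?_)
  rw [errV, Real.norm_of_nonneg (hV.nonneg _ _)]
  exact hS _ _ (norm_u_le_level _ _ _) (norm_u_le_level _ _ _)

/-- Projection, isometry and the Euler step estimate combined. The integral runs over an arbitrary
past event, which replaces conditional expectation: the maximal inequality needs such events, while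
the energy decay needs only the whole space. -/
theorem setIntegral_errSq_succ_le (hX : IsWhiteNoise P (incr W Δ) Δ) (hΔ : 0 ≤ Δ) (h1 : H1 f g)
    {b₁ b₂ b₃ b₄ : ℝ} {V : E d → E d → ℝ} (h3 : H3 f g b₁ b₂ b₃ b₄ V)
    {Φ : Set.Ici (1 : ℝ) → ℝ} (hΦ : IsControl f g Φ) {q : ℝ} (hq : Φ ρ ^ 2 * Δ ≤ q) (j : ℕ)
    {A : Set Ω} (hA : MeasurableSet[past (incr W Δ) j] A) :
    ∫ ω in A, errSq f g ρ hτ Δ N ξ ζ W (j + 1) ω ∂P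
      ≤ ∫ ω in A, (errSq f g ρ hτ Δ N ξ ζ W j ω
        + Δ * (-(b₁ - 2 * q) * errSq f g ρ hτ Δ N ξ ζ W j ω
          + (b₂ + 2 * q) * errSq f g ρ hτ Δ N ξ ζ W (j - N) ω
          - b₃ * errV f g ρ hτ Δ N ξ ζ W V j ω
          + b₄ * errV f g ρ hτ Δ N ξ ζ W V (j - N) ω)) ∂P := by
  have hub : ∀ (η : Seg d τ) (ω : Ω) (k : ℤ), ‖u f g ρ hτ Δ N η (fun t => W t ω) k‖ ≤ ρ :=
    fun η ω k => norm_u_le_level _ _ _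
  have hum : ∀ η : Seg d τ, Measurable[past (incr W Δ) j] fun ω =>
      (u f g ρ hτ Δ N η (fun t => W t ω) j, u f g ρ hτ Δ N η (fun t => W t ω) (j - N)) :=
    fun η => (measurable_u h1 η W j j le_rfl).prodMk (measurable_u h1 η W j (j - N) (by omega))
  let a : Ω → E d := fun ω => u f g ρ hτ Δ N ξ (fun t => W t ω) j
    - u f g ρ hτ Δ N ζ (fun t => W t ω) j
    + Δ • (f (u f g ρ hτ Δ N ξ (fun t => W t ω) j) (u f g ρ hτ Δ N ξ (fun t => W t ω) (j - N))
      - f (u f g ρ hτ Δ N ζ (fun t => W t ω) j) (u f g ρ hτ Δ N ζ (fun t => W t ω) (j - N)))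
  let G : Ω → Matrix (Fin d) (Fin m) ℝ := fun ω =>
    g (u f g ρ hτ Δ N ξ (fun t => W t ω) j) (u f g ρ hτ Δ N ξ (fun t => W t ω) (j - N))
      - g (u f g ρ hτ Δ N ζ (fun t => W t ω) j) (u f g ρ hτ Δ N ζ (fun t => W t ω) (j - N))
  have ham : Measurable[past (incr W Δ) j] a :=
    ((measurable_fst.comp (hum ξ)).sub (measurable_fst.comp (hum ζ))).add
      (((h1.continuous_drift.measurable.comp (hum ξ)).sub
        (h1.continuous_drift.measurable.comp (hum ζ))).const_smul Δ)
  have hGm : ∀ i l, Measurable[past (incr W Δ) j] fun ω => G ω i l := fun i l =>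
    ((h1.continuous_diffusion i l).measurable.comp (hum ξ)).sub
      ((h1.continuous_diffusion i l).measurable.comp (hum ζ))
  -- Deterministic bounds for the isometry, from the Lipschitz constant on the ball of radius `ρ`.
  -- They may depend on the step, since they enter only through integrability.
  obtain ⟨ℓ, hℓ, hlip⟩ := h1 ρ (level_pos ρ)
  have hρ := level_pos ρ
  have hlip' : ∀ ω, _ := fun ω => (hlip _ _ _ _ (hub ξ ω j) (hub ζ ω j) (hub ξ ω (j - N))
    (hub ζ ω (j - N))).trans (mul_le_mul_of_nonneg_left (add_le_add
      ((norm_sub_le _ _).trans (add_le_add (hub ξ ω j) (hub ζ ω j)))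
      ((norm_sub_le _ _).trans (add_le_add (hub ξ ω (j - N)) (hub ζ ω (j - N))))) hℓ.le)
  set B : ℝ := ℓ * (ρ + ρ + (ρ + ρ)) with hB
  have hB0 : 0 ≤ B := by positivity
  have haC : ∀ ω, ‖a ω‖ ≤ ρ + ρ + Δ * B + B := fun ω => by
    refine (norm_add_le _ _).trans ?_
    rw [norm_smul, Real.norm_of_nonneg hΔ]
    have h4 := (norm_sub_le (u f g ρ hτ Δ N ξ (fun t => W t ω) j)
      (u f g ρ hτ Δ N ζ (fun t => W t ω) j)).trans (add_le_add (hub ξ ω j) (hub ζ ω j))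
    have h5 := mul_le_mul_of_nonneg_left ((le_max_left _ _).trans (hlip' ω)) hΔ
    linarith
  have hGC : ∀ ω, ‖G ω‖ ≤ ρ + ρ + Δ * B + B := fun ω => by
    have h4 : ‖G ω‖ ≤ B := (le_max_right _ _).trans (hlip' ω)
    have h5 : 0 ≤ Δ * B := mul_nonneg hΔ hB0
    linarith
  obtain ⟨hi, he⟩ := hX.setIntegral_norm_sq ham haC hGm hGC hA
  have hAm : MeasurableSet A := hX.past_le j A hA
  have hstep : ∀ ω, errSq f g ρ hτ Δ N ξ ζ W (j + 1) ω
      ≤ ‖a ω + WithLp.toLp 2 (G ω *ᵥ fun l => incr W Δ (l, j) ω)‖ ^ 2 := fun ω => by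
    refine pow_le_pow_left₀ (norm_nonneg _) ((norm_trunc_sub_trunc_le ρ _ _).trans_eq ?_) 2
    rw [breveU_succ, breveU_succ]
    congr 1
    simp only [a, G, Matrix.sub_mulVec, WithLp.toLp_sub, smul_sub]
    abel
  have hD := fun k => (integrable_errSq (ρ := ρ) (hτ := hτ) (N := N) (ξ := ξ) (ζ := ζ) hX h1 k)
  have hVi := fun k =>
    (integrable_errV (ρ := ρ) (hτ := hτ) (N := N) (ξ := ξ) (ζ := ζ) hX h1 h3.hatC k)
  refine (setIntegral_mono_on (hD _).integrableOn hi hAm fun ω _ => hstep ω).trans ?_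
  rw [he]
  refine integral_mono_of_nonneg (.of_forall fun ω => by positivity) ?_ (.of_forall fun ω => ?_)
  · exact ((hD _).add ((((((hD _).const_mul _).add ((hD _).const_mul _)).sub
      ((hVi _).const_mul _)).add ((hVi _).const_mul _)).const_mul Δ)).integrableOn
  · exact h3.euler_step_le hΦ ρ hΔ hq (hub ξ ω j) (hub ζ ω j) (hub ξ ω (j - N)) (hub ζ ω (j - N))

theorem integral_errSq_succ_le (hX : IsWhiteNoise P (incr W Δ) Δ) (hΔ : 0 ≤ Δ) (h1 : H1 f g)
    {b₁ b₂ b₃ b₄ : ℝ} {V : E d → E d → ℝ} (h3 : H3 f g b₁ b₂ b₃ b₄ V)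
    {Φ : Set.Ici (1 : ℝ) → ℝ} (hΦ : IsControl f g Φ) {q : ℝ} (hq : Φ ρ ^ 2 * Δ ≤ q) (j : ℕ) :
    ∫ ω, errSq f g ρ hτ Δ N ξ ζ W (j + 1) ω ∂P
      ≤ ∫ ω, errSq f g ρ hτ Δ N ξ ζ W j ω ∂P
        + Δ * (-(b₁ - 2 * q) * ∫ ω, errSq f g ρ hτ Δ N ξ ζ W j ω ∂P
          + (b₂ + 2 * q) * ∫ ω, errSq f g ρ hτ Δ N ξ ζ W (j - N) ω ∂P
          - b₃ * ∫ ω, errV f g ρ hτ Δ N ξ ζ W V j ω ∂P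
          + b₄ * ∫ ω, errV f g ρ hτ Δ N ξ ζ W V (j - N) ω ∂P) := by
  have h := setIntegral_errSq_succ_le (hτ := hτ) (N := N) (ξ := ξ) (ζ := ζ) hX hΔ h1 h3 hΦ hq j
    MeasurableSet.univ
  have hD := fun k => (integrable_errSq (ρ := ρ) (hτ := hτ) (N := N) (ξ := ξ) (ζ := ζ) hX h1 k)
  have hVi := fun k =>
    (integrable_errV (ρ := ρ) (hτ := hτ) (N := N) (ξ := ξ) (ζ := ζ) hX h1 h3.hatC k)
  have i1 := ((hD j).const_mul (-(b₁ - 2 * q))).add ((hD (j - N)).const_mul (b₂ + 2 * q))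
  have i2 := i1.sub ((hVi j).const_mul b₃)
  have i3 := i2.add ((hVi (j - N)).const_mul b₄)
  rw [setIntegral_univ, setIntegral_univ, integral_add (hD j) (by exact i3.const_mul Δ),
    integral_const_mul, integral_add (by exact i2) ((hVi _).const_mul _),
    integral_sub (by exact i1) ((hVi _).const_mul _),
    integral_add ((hD _).const_mul _) ((hD _).const_mul _)] at h
  simpa only [integral_const_mul] using h

/-- The probability that the error is large somewhere on a window of length `N` is controlled by
the energy at the beginning of the window. -/
theorem mul_prob_errSq_window_le (hX : IsWhiteNoise P (incr W Δ) Δ) (hΔ : 0 ≤ Δ) (h1 : H1 f g)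
    {b₁ b₂ b₃ b₄ : ℝ} {V : E d → E d → ℝ} (h3 : H3 f g b₁ b₂ b₃ b₄ V)
    {Φ : Set.Ici (1 : ℝ) → ℝ} (hΦ : IsControl f g Φ) {q : ℝ} (hq : Φ ρ ^ 2 * Δ ≤ q)
    (hqb : 2 * q ≤ b₁) (n : ℕ) (r : ℝ) :
    r * P.real {ω | ∃ i ≤ N, r ≤ errSq f g ρ hτ Δ N ξ ζ W ((n + i : ℕ) : ℤ) ω}
      ≤ windowEnergy N Δ (b₂ + 2 * q) b₄
        (fun k => ∫ ω, errSq f g ρ hτ Δ N ξ ζ W ((k : ℤ) - N) ω ∂P)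
        (fun k => ∫ ω, errV f g ρ hτ Δ N ξ ζ W V ((k : ℤ) - N) ω ∂P) n := by
  have hq0 : 0 ≤ q := (mul_nonneg (sq_nonneg _) hΔ).trans hq
  have hc₂ : 0 ≤ b₂ + 2 * q := by linarith [h3.b₂_nonneg]
  have hD := fun k => (integrable_errSq (ρ := ρ) (hτ := hτ) (N := N) (ξ := ξ) (ζ := ζ) hX h1 k)
  have hVi := fun k =>
    (integrable_errV (ρ := ρ) (hτ := hτ) (N := N) (ξ := ξ) (ζ := ζ) hX h1 h3.hatC k)
  let T : ℕ → Ω → ℝ := fun l ω =>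
    (b₂ + 2 * q) * errSq f g ρ hτ Δ N ξ ζ W (((n + l : ℕ) : ℤ) - N) ω
      + b₄ * errV f g ρ hτ Δ N ξ ζ W V (((n + l : ℕ) : ℤ) - N) ω
  have hT0 : ∀ l ω, 0 ≤ T l ω := fun l ω => add_nonneg (mul_nonneg hc₂ (errSq_nonneg _ _))
    (mul_nonneg h3.b₄_nonneg (h3.hatC.nonneg _ _))
  have hTi : ∀ l, Integrable (T l) P := fun l => ((hD _).const_mul _).add ((hVi _).const_mul _)
  -- Error plus forcing still to come in the window. As `l < N`, the forcing `T l` involves times `n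
  -- + l - N < n`, so `Z i` is adapted although it sums over future steps.
  let Z : ℕ → Ω → ℝ := fun i ω => errSq f g ρ hτ Δ N ξ ζ W ((n + i : ℕ) : ℤ) ω
    + Δ * ∑ l ∈ Finset.Ico i N, T l ω
  have hSi : ∀ i, Integrable (fun ω => Δ * ∑ l ∈ Finset.Ico i N, T l ω) P := fun i =>
    (integrable_finsetSum _ fun l _ => hTi l).const_mul Δ
  have hSZ : ∀ i ω, 0 ≤ Δ * ∑ l ∈ Finset.Ico i N, T l ω := fun i ω =>
    mul_nonneg hΔ (Finset.sum_nonneg fun l _ => hT0 l ω)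
  have hZi : ∀ i, Integrable (Z i) P := fun i => (hD _).add (hSi i)
  have hmax := supermartingale_maximal (P := P) (F := fun i => past (incr W Δ) (n + i)) (Z := Z)
    (N := N) (fun i j hij => past_mono _ (Nat.add_le_add_left hij n)) (fun i => hX.past_le _)
    (fun i => (measurable_errSq h1 le_rfl).add
      ((Finset.measurable_fun_sum _ fun l hl => by
        have hl' := (Finset.mem_Ico.1 hl).2
        exact ((measurable_errSq h1 (by push_cast; omega)).const_mul _).add
          ((measurable_errV h1 h3.hatC.continuous (by push_cast; omega)).const_mul _)).const_mul Δ))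
    (fun i ω => add_nonneg (errSq_nonneg _ _) (hSZ i ω)) hZi ?_ r
  · have e0 : ∫ ω, Z 0 ω ∂P = windowEnergy N Δ (b₂ + 2 * q) b₄
        (fun k => ∫ ω, errSq f g ρ hτ Δ N ξ ζ W ((k : ℤ) - N) ω ∂P)
        (fun k => ∫ ω, errV f g ρ hτ Δ N ξ ζ W V ((k : ℤ) - N) ω ∂P) n := by
      simp only [Z, windowEnergy]
      rw [integral_add (hD _) (hSi 0), integral_const_mul, integral_finsetSum _ fun l _ => hTi l,
        Finset.range_eq_Ico]
      congr 2
      · push_cast; simp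
      · refine Finset.sum_congr rfl fun l _ => ?_
        simp only [T]
        rw [integral_add ((hD _).const_mul _) ((hVi _).const_mul _), integral_const_mul,
          integral_const_mul]
    rw [← e0]
    refine le_trans ?_ hmax
    rcases le_or_gt r 0 with hr | hr
    · have hall : {ω | ∃ i ≤ N, r ≤ errSq f g ρ hτ Δ N ξ ζ W ((n + i : ℕ) : ℤ) ω} = Set.univ :=
        Set.eq_univ_of_forall fun ω => ⟨0, N.zero_le, hr.trans (errSq_nonneg _ _)⟩
      have hall' : {ω | ∃ i ≤ N, r ≤ Z i ω} = Set.univ :=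
        Set.eq_univ_of_forall fun ω =>
          ⟨0, N.zero_le, hr.trans (add_nonneg (errSq_nonneg _ _) (hSZ 0 ω))⟩
      rw [hall, hall']
    · refine mul_le_mul_of_nonneg_left (measureReal_mono ?_) hr.le
      rintro ω ⟨i, hi, h⟩
      exact ⟨i, hi, h.trans (le_add_of_nonneg_right (hSZ i ω))⟩
  · intro i hi A hA
    have hstep := setIntegral_errSq_succ_le (hτ := hτ) (N := N) (ξ := ξ) (ζ := ζ) hX hΔ h1 h3 hΦ hq
      (n + i) hA
    -- The dissipative terms are discarded; `2 * q ≤ b₁` gives the sign of the first. The forcing `T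
    -- i` that remains is exactly what `Z` loses from `i` to `i + 1`.
    have hle : ∀ ω, errSq f g ρ hτ Δ N ξ ζ W ((n + i : ℕ) : ℤ) ω
        + Δ * (-(b₁ - 2 * q) * errSq f g ρ hτ Δ N ξ ζ W ((n + i : ℕ) : ℤ) ω
          + (b₂ + 2 * q) * errSq f g ρ hτ Δ N ξ ζ W (((n + i : ℕ) : ℤ) - N) ω
          - b₃ * errV f g ρ hτ Δ N ξ ζ W V ((n + i : ℕ) : ℤ) ω
          + b₄ * errV f g ρ hτ Δ N ξ ζ W V (((n + i : ℕ) : ℤ) - N) ω)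
        ≤ errSq f g ρ hτ Δ N ξ ζ W ((n + i : ℕ) : ℤ) ω + Δ * T i ω := fun ω => by
      refine add_le_add le_rfl (mul_le_mul_of_nonneg_left ?_ hΔ)
      have h4 := mul_nonneg (sub_nonneg.2 hqb)
        (errSq_nonneg (f := f) (g := g) (ρ := ρ) (hτ := hτ) (Δ := Δ) (N := N) (ξ := ξ) (ζ := ζ)
          (W := W) ((n + i : ℕ) : ℤ) ω)
      have h5 : 0 ≤ b₃ * errV f g ρ hτ Δ N ξ ζ W V ((n + i : ℕ) : ℤ) ω :=
        mul_nonneg h3.b₃_nonneg (h3.hatC.nonneg _ _)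
      simp only [T]
      linarith
    have hmono : ∫ ω in A, errSq f g ρ hτ Δ N ξ ζ W (((n + i : ℕ) : ℤ) + 1) ω ∂P
        ≤ ∫ ω in A, (errSq f g ρ hτ Δ N ξ ζ W ((n + i : ℕ) : ℤ) ω + Δ * T i ω) ∂P := by
      refine hstep.trans (setIntegral_mono_on ?_ ?_ (hX.past_le _ A hA) fun ω _ => hle ω)
      · exact ((hD _).add ((((((hD _).const_mul _).add ((hD _).const_mul _)).sub
          ((hVi _).const_mul _)).add ((hVi _).const_mul _)).const_mul Δ)).integrableOn
      · exact ((hD _).add ((hTi i).const_mul Δ)).integrableOn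
    have e1 : ∫ ω in A, Z i ω ∂P
        = ∫ ω in A, (errSq f g ρ hτ Δ N ξ ζ W ((n + i : ℕ) : ℤ) ω + Δ * T i ω) ∂P
          + ∫ ω in A, Δ * ∑ l ∈ Finset.Ico (i + 1) N, T l ω ∂P := by
      rw [← integral_add (by exact ((hD _).add ((hTi i).const_mul Δ)).integrableOn)
        (hSi (i + 1)).integrableOn]
      refine integral_congr_ae (.of_forall fun ω => ?_)
      simp only [Z]
      rw [Finset.sum_eq_sum_Ico_succ_bot hi, mul_add, add_assoc]
    rw [e1, integral_add (hD _).integrableOn (hSi (i + 1)).integrableOn]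
    refine add_le_add ?_ le_rfl
    have e2 : ((n + (i + 1) : ℕ) : ℤ) = ((n + i : ℕ) : ℤ) + 1 := by push_cast; ring
    rw [e2]
    exact hmono

end Error

/-! ### From grid points to segments, and the initial energy. -/

/-- The sup norm of a difference of segments is controlled by the values at the grid points. -/
theorem norm_Y_sub_lt {d m : ℕ} {f : E d → E d → E d} {g : E d → E d → Matrix (Fin d) (Fin m) ℝ}
    {Φ : Set.Ici (1 : ℝ) → ℝ} {ν τ : ℝ} {hτ : 0 < τ} {Δ : ℝ} {N : ℕ} {ξ ζ : Seg d τ}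
    {w : ℝ≥0 → E m} {n : ℕ} {ε : ℝ} (hε : 0 < ε) (hΔ : 0 < Δ) (hN : N * Δ = τ) (hn : 0 < n)
    (h : ∀ i ≤ N, ‖u f g (level f g Φ ν Δ) hτ Δ N ξ w ((n + i : ℕ) : ℤ)
      - u f g (level f g Φ ν Δ) hτ Δ N ζ w ((n + i : ℕ) : ℤ)‖ < ε) :
    ‖Y f g Φ ν hτ Δ N ξ w (n + N) - Y f g Φ ν hτ Δ N ζ w (n + N)‖ < ε := by
  rw [ContinuousMap.norm_lt_iff _ hε]
  rintro ⟨θ, hθ⟩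
  set t : ℝ := ((n + N : ℕ) : ℝ) * Δ + θ with ht
  have ht' : t = n * Δ + (N * Δ + θ) := by rw [ht]; push_cast; ring
  have hnn : 0 ≤ N * Δ + θ := by rw [hN]; linarith [hθ.1]
  have ht0 : 0 < t := by
    rw [ht']
    have : 0 < (n : ℝ) * Δ := mul_pos (by exact_mod_cast hn) hΔ
    linarith
  have hs1 : (n : ℝ) ≤ t / Δ := by rw [le_div_iff₀ hΔ]; linarith
  have hs2 : t / Δ ≤ ((n + N : ℕ) : ℝ) := by rw [div_le_iff₀ hΔ]; linarith [hθ.2]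
  have hmem : ∀ k : ℤ, (n : ℤ) ≤ k → k ≤ ((n + N : ℕ) : ℤ) →
      ‖u f g (level f g Φ ν Δ) hτ Δ N ξ w k - u f g (level f g Φ ν Δ) hτ Δ N ζ w k‖ < ε := by
    intro k hk1 hk2
    obtain ⟨i, rfl⟩ : ∃ i : ℕ, k = ((n + i : ℕ) : ℤ) := ⟨(k - n).toNat, by push_cast; omega⟩
    exact h i (by omega)
  change ‖y f g (level f g Φ ν Δ) hτ Δ N ξ w t - y f g (level f g Φ ν Δ) hτ Δ N ζ w t‖ < ε
  rw [y, if_neg ht0.not_ge, y, if_neg ht0.not_ge]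
  have hfl1 : (n : ℤ) ≤ ⌊t / Δ⌋ := Int.le_floor.2 (by exact_mod_cast hs1)
  have hsub : ∀ p q : ℤ → E d, interp p (t / Δ) - interp q (t / Δ)
      = ((⌊t / Δ⌋ : ℝ) + 1 - t / Δ) • (p ⌊t / Δ⌋ - q ⌊t / Δ⌋)
        + (t / Δ - ⌊t / Δ⌋) • (p (⌊t / Δ⌋ + 1) - q (⌊t / Δ⌋ + 1)) := fun p q => by
    simp only [interp, smul_sub]
    abel
  rw [hsub]
  -- At the right endpoint the second interpolation node `n + N + 1` lies outside the window, but
  -- its weight is zero.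
  rcases hs2.lt_or_eq with hlt | heq
  · have hfl2 : ⌊t / Δ⌋ < ((n + N : ℕ) : ℤ) := Int.floor_lt.2 (by exact_mod_cast hlt)
    have h1 := hmem ⌊t / Δ⌋ hfl1 hfl2.le
    have h2 := hmem (⌊t / Δ⌋ + 1) (by omega) (by omega)
    rw [← mem_ball_zero_iff] at h1 h2 ⊢
    exact convex_ball (0 : E d) ε h1 h2 (by linarith [Int.lt_floor_add_one (t / Δ)])
      (by linarith [Int.floor_le (t / Δ)]) (by ring)
  · have hfl : ⌊t / Δ⌋ = ((n + N : ℕ) : ℤ) := by rw [heq]; exact Int.floor_natCast _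
    have h1 := hmem ((n + N : ℕ) : ℤ) (by push_cast; omega) le_rfl
    rw [hfl, heq]
    simpa using h1

/-- The energy of the initial data is bounded uniformly over `B(M)` and over the step size. -/
theorem windowEnergy_zero_le {Ω : Type*} [MeasurableSpace Ω] {P : Measure Ω}
    [IsProbabilityMeasure P] {d m : ℕ} {f : E d → E d → E d}
    {g : E d → E d → Matrix (Fin d) (Fin m) ℝ} {ρ : Set.Ici (1 : ℝ)} {τ : ℝ} {hτ : 0 < τ} {Δ : ℝ}
    {N : ℕ} {ξ ζ : Seg d τ} {W : ℝ≥0 → Ω → E m} {V : E d → E d → ℝ} {M S c b : ℝ} (hΔ : 0 ≤ Δ)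
    (hV : ∀ x y, 0 ≤ V x y) (hS : ∀ x y : E d, ‖x‖ ≤ M → ‖y‖ ≤ M → V x y ≤ S) (hc : 0 ≤ c)
    (hb : 0 ≤ b) (hξ : ‖ξ‖ ≤ M) (hζ : ‖ζ‖ ≤ M) :
    windowEnergy N Δ c b (fun k => ∫ ω, errSq f g ρ hτ Δ N ξ ζ W ((k : ℤ) - N) ω ∂P)
        (fun k => ∫ ω, errV f g ρ hτ Δ N ξ ζ W V ((k : ℤ) - N) ω ∂P) 0
      ≤ (M + M) ^ 2 + N * Δ * (c * (M + M) ^ 2 + b * S) := by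
  have hle : ∀ (X : Ω → ℝ) (C : ℝ), (∀ ω, 0 ≤ X ω) → (∀ ω, X ω ≤ C) → ∫ ω, X ω ∂P ≤ C := by
    intro X C h0 hC
    have h := integral_mono_of_nonneg (μ := P) (.of_forall h0) (integrable_const C) (.of_forall hC)
    simpa using h
  have hu : ∀ (η : Seg d τ), ‖η‖ ≤ M → ∀ (ω : Ω) (k : ℤ), k ≤ 0 →
      ‖u f g ρ hτ Δ N η (fun t => W t ω) k‖ ≤ M :=
    fun η hη ω k hk => (norm_u_le_norm _ _ hk).trans hη
  have hx : ∀ k : ℤ, k ≤ 0 → ∫ ω, errSq f g ρ hτ Δ N ξ ζ W k ω ∂P ≤ (M + M) ^ 2 := fun k hk =>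
    hle _ _ (fun ω => errSq_nonneg _ _) fun ω => pow_le_pow_left₀ (norm_nonneg _)
      ((norm_sub_le _ _).trans (add_le_add (hu ξ hξ ω k hk) (hu ζ hζ ω k hk))) 2
  have hv : ∀ k : ℤ, k ≤ 0 → ∫ ω, errV f g ρ hτ Δ N ξ ζ W V k ω ∂P ≤ S := fun k hk =>
    hle _ _ (fun ω => hV _ _) fun ω => hS _ _ (hu ξ hξ ω k hk) (hu ζ hζ ω k hk)
  -- At window index `0` all times are nonpositive, so only the truncated initial segments occur.
  unfold windowEnergy
  refine add_le_add (hx _ (by simp)) ?_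
  have hsum : ∑ i ∈ Finset.range N,
      (c * ∫ ω, errSq f g ρ hτ Δ N ξ ζ W (((0 + i : ℕ) : ℤ) - N) ω ∂P
        + b * ∫ ω, errV f g ρ hτ Δ N ξ ζ W V (((0 + i : ℕ) : ℤ) - N) ω ∂P)
      ≤ ∑ _i ∈ Finset.range N, (c * (M + M) ^ 2 + b * S) := by
    refine Finset.sum_le_sum fun i hi => ?_
    have hi' := Finset.mem_range.1 hi
    exact add_le_add (mul_le_mul_of_nonneg_left (hx _ (by omega)) hc)
      (mul_le_mul_of_nonneg_left (hv _ (by omega)) hb)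
  rw [Finset.sum_const, Finset.card_range, nsmul_eq_mul] at hsum
  calc _ ≤ Δ * (N * (c * (M + M) ^ 2 + b * S)) := mul_le_mul_of_nonneg_left hsum hΔ
    _ = _ := by ring

end TEMSP

/-! ### Choice of constants and conclusion. -/

theorem proposition4p2 {d m : ℕ}
    {Ω : Type*} [MeasurableSpace Ω] (P : Measure Ω) [IsProbabilityMeasure P]
    (W : ℝ≥0 → Ω → TEMSP.E m) (hW : TEMSP.IsBrownianMotion P W)
    (τ : ℝ) (hτ : 0 < τ)
    (f : TEMSP.E d → TEMSP.E d → TEMSP.E d)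
    (g : TEMSP.E d → TEMSP.E d → Matrix (Fin d) (Fin m) ℝ)
    (α a₁ a₂ a₃ b₁ b₂ b₃ b₄ : ℝ) (V : TEMSP.E d → TEMSP.E d → ℝ)
    (h1 : TEMSP.H1 f g)
    (h2 : TEMSP.H2 f g α a₁ a₂ a₃)
    (h3 : TEMSP.H3 f g b₁ b₂ b₃ b₄ V)
    (Φ : Set.Ici (1 : ℝ) → ℝ) (hΦ : TEMSP.IsControl f g Φ)
    (ν : ℝ) (hν : ν ∈ Set.Ioc (0 : ℝ) (1 / 3))
    (Δ₁ Δ₂ : ℝ) (hΔ₁ : Δ₁ ∈ Set.Ioo (0 : ℝ) 1) (hΔ₂ : Δ₂ ∈ Set.Ioo (0 : ℝ) 1)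
    (hstep₁ : a₂ - 6 * TEMSP.constK f g Φ ^ 2 * Δ₁ ^ (1 - 2 * ν) > a₃)
    (hstep₂ : b₁ - 4 * TEMSP.constK f g Φ ^ 2 * Δ₂ ^ (1 - 2 * ν) > b₂)
    (M ε : ℝ) (hM : 0 < M) (hε : 0 < ε) :
    ∃ T : ℝ, τ < T ∧
      ∀ (Δ : ℝ) (N : ℕ), Δ = τ / N → Δ ∈ Set.Ioc (0 : ℝ) (min Δ₁ Δ₂) →
        ∀ k : ℕ, T ≤ (k : ℝ) * Δ →
          (⨆ ξ ∈ TEMSP.B d τ M, ⨆ ζ ∈ TEMSP.B d τ M,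
            P {ω | ε ≤ ‖TEMSP.Y f g Φ ν hτ Δ N ξ (fun t => W t ω) k
                        - TEMSP.Y f g Φ ν hτ Δ N ζ (fun t => W t ω) k‖})
            < ENNReal.ofReal ε := by
  open TEMSP in
  obtain ⟨S, hS0, hS⟩ := h3.hatC.exists_bound M
  set q : ℝ := constK f g Φ ^ 2 * Δ₂ ^ (1 - 2 * ν) with hq
  have hq0 : 0 ≤ q := mul_nonneg (sq_nonneg _) (Real.rpow_nonneg hΔ₂.1.le _)
  -- The gap equals `b₁ - b₂ - 4 * q`, which is where the factor `4` in `hstep₂` is used.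
  have hκ : 0 < (b₁ - 2 * q) - (b₂ + 2 * q) := by linarith
  have hκ' : 0 < b₃ - b₄ := sub_pos.2 h3.lt₃₄
  have hc₂ : 0 ≤ b₂ + 2 * q := by linarith [h3.b₂_nonneg]
  have hb₄ := h3.b₄_nonneg
  set D : ℝ := 1 / ((b₁ - 2 * q) - (b₂ + 2 * q))
    + τ * (1 + (b₂ + 2 * q) / ((b₁ - 2 * q) - (b₂ + 2 * q)) + b₄ / (b₃ - b₄)) with hD
  have hD0 : 0 ≤ D := by positivity
  set C : ℝ := D * ((M + M) ^ 2 + τ * ((b₂ + 2 * q) * (M + M) ^ 2 + b₄ * S)) with hC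
  have hC0 : 0 ≤ C := by positivity
  -- With `k = n + N`, one `τ` is the length of the final window and the other makes the bound
  -- exceed `τ`. The last term makes `C / (n Δ) ≤ ε ^ 3 / 2`, hence the probability at most `ε / 2`
  -- after division by `ε ^ 2`.
  refine ⟨τ + τ + 2 * C / ε ^ 3, by have : 0 ≤ 2 * C / ε ^ 3 := by positivity
                                    linarith, ?_⟩
  intro Δ N hΔN hΔ k hk
  have hΔ0 := hΔ.1
  have hΔle : Δ ≤ Δ₂ := hΔ.2.trans (min_le_right _ _)
  have hN0 : (N : ℝ) ≠ 0 := fun h => by rw [hΔN, h, div_zero] at hΔ0; exact hΔ0.false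
  have hNΔ : N * Δ = τ := by rw [hΔN]; field_simp
  have hkN : N < k := by
    have h4 : (N : ℝ) * Δ < k * Δ := by
      have : 0 ≤ 2 * C / ε ^ 3 := by positivity
      rw [hNΔ]; linarith
    exact_mod_cast lt_of_mul_lt_mul_right h4 hΔ0.le
  obtain ⟨n, rfl⟩ : ∃ n, k = n + N := ⟨k - N, by omega⟩
  have hn : 0 < n := by omega
  have hnΔ : τ + 2 * C / ε ^ 3 ≤ n * Δ := by
    push_cast at hk
    rw [add_mul, hNΔ] at hk
    linarith
  have hnΔ0 : 0 < n * Δ := mul_pos (by exact_mod_cast hn) hΔ0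
  have hΦq : Φ (level f g Φ ν Δ) ^ 2 * Δ ≤ q := by
    rw [hΦ.apply_level hν.1.le ⟨hΔ0, hΔle.trans hΔ₂.2.le⟩, mul_pow, mul_assoc]
    refine mul_le_mul_of_nonneg_left ?_ (sq_nonneg _)
    have e : (Δ ^ (-ν)) ^ 2 * Δ = Δ ^ (1 - 2 * ν) := by
      rw [← Real.rpow_natCast (Δ ^ (-ν)) 2, ← Real.rpow_mul hΔ0.le]
      nth_rewrite 2 [← Real.rpow_one Δ]
      rw [← Real.rpow_add hΔ0]
      congr 1
      push_cast
      ring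
    rw [e]
    -- The exponent `1 - 2ν` is positive since `ν ≤ 1/3`, so the largest step is the worst case.
    exact Real.rpow_le_rpow hΔ0.le hΔle (by linarith [hν.2])
  have hX := hW.isWhiteNoise_incr hΔ0.le
  -- A supremum preserves only weak inequalities, hence the target `ε / 2` for each pair.
  refine lt_of_le_of_lt (b := ENNReal.ofReal (ε / 2)) ?_
    ((ENNReal.ofReal_lt_ofReal_iff hε).2 (by linarith))
  refine iSup₂_le fun ξ hξ => iSup₂_le fun ζ hζ => ?_
  have hmax := mul_prob_errSq_window_le (hτ := hτ) (N := N) (ξ := ξ) (ζ := ζ) hX hΔ0.le h1 h3 hΦ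
    hΦq (by linarith [h3.b₂_nonneg]) n (ε ^ 2)
  have hdecay := mul_windowEnergy_le (N := N) hΔ0.le hκ hκ' le_rfl le_rfl hc₂ hb₄
    (x := fun k => ∫ ω, errSq f g (level f g Φ ν Δ) hτ Δ N ξ ζ W ((k : ℤ) - N) ω ∂P)
    (v := fun k => ∫ ω, errV f g (level f g Φ ν Δ) hτ Δ N ξ ζ W V ((k : ℤ) - N) ω ∂P)
    (fun k => integral_nonneg fun ω => errSq_nonneg _ _)
    (fun k => integral_nonneg fun ω => h3.hatC.nonneg _ _)
    (fun j => by
      have h := integral_errSq_succ_le (hτ := hτ) (N := N) (ξ := ξ) (ζ := ζ) hX hΔ0.le h1 h3 hΦ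
        hΦq j
      have e1 : ((j + N + 1 : ℕ) : ℤ) - N = j + 1 := by push_cast; ring
      have e2 : ((j + N : ℕ) : ℤ) - N = j := by push_cast; ring
      simp only [e1, e2]
      exact h) n
  rw [hNΔ] at hdecay
  have hinit := windowEnergy_zero_le (P := P) (f := f) (g := g) (ρ := level f g Φ ν Δ) (hτ := hτ)
    (N := N) (W := W) hΔ0.le h3.hatC.nonneg hS hc₂ hb₄ hξ hζ
  rw [hNΔ] at hinit
  have hfin := hdecay.trans (mul_le_mul_of_nonneg_left hinit hD0)
  set p : ℝ := P.real {ω | ∃ i ≤ N, ε ^ 2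
    ≤ errSq f g (level f g Φ ν Δ) hτ Δ N ξ ζ W ((n + i : ℕ) : ℤ) ω} with hp
  have hpε : p ≤ ε / 2 := by
    have h4 : n * Δ * (ε ^ 2 * p) ≤ C := (mul_le_mul_of_nonneg_left hmax hnΔ0.le).trans hfin
    have h5 : C ≤ n * Δ * (ε ^ 2 * (ε / 2)) := by
      have h6 : 2 * C / ε ^ 3 ≤ n * Δ := by linarith
      rw [div_le_iff₀ (by positivity)] at h6
      linarith
    have h7 := le_of_mul_le_mul_left (h4.trans h5) hnΔ0
    exact le_of_mul_le_mul_left h7 (by positivity)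
  calc P {ω | ε ≤ ‖Y f g Φ ν hτ Δ N ξ (fun t => W t ω) (n + N)
          - Y f g Φ ν hτ Δ N ζ (fun t => W t ω) (n + N)‖}
      ≤ P {ω | ∃ i ≤ N, ε ^ 2
          ≤ errSq f g (level f g Φ ν Δ) hτ Δ N ξ ζ W ((n + i : ℕ) : ℤ) ω} := by
        refine measure_mono fun ω hω => ?_
        by_contra hcon
        simp only [Set.mem_ofPred_eq, not_exists, not_and, not_le] at hcon
        refine (norm_Y_sub_lt hε hΔ0 hNΔ hn fun i hi => ?_).not_ge hω
        exact lt_of_pow_lt_pow_left₀ 2 hε.le (hcon i hi)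
    _ = ENNReal.ofReal p := (ofReal_measureReal (measure_ne_top _ _)).symm
    _ ≤ ENNReal.ofReal (ε / 2) := ENNReal.ofReal_le_ofReal hpε
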